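/- **Setting.** Let $S$ be a finite set of $n\ge 2$ points of a metric space with distance $d$, let $\mathcal M=(S,\mathcal I)$ be a matroid in which all singletons of $S$ are independent, and let $1\le k\le \operatorname{rank}(\mathcal M)$. The matroid is given as one of three types: a *partition matroid*, whose categories $A_1,\dots,A_h$ partition $S$ and for which $X\in\mathcal I$ iff $|X\cap A_i|\le k_i$ for all $i$ (with $k_i\le|A_i|$); a *transversal matroid*, whose categories $A_1,\dots,A_h$ cover $S$ and for which $X\in\mathcal I$ iff the points of $X$ can be matched to distinct categories that contain them, where each point belongs to at most $\gamma=O(1)$ categories; or any *other* matroid. The diversity $\operatorname{div}(X)$ is one of: the sum of the distances over all unordered pairs of $X$ (sum); the minimum over $c\in X$ of $\sum_{u\in X\setminus\{c\}}d(c,u)$ (star); the minimum weight of a spanning tree on $X$ (tree); the minimum length of a closed tour visiting each point of $X$ once (cycle); the minimum of $\sum_{u\in Q,\,v\in X\setminus Q}d(u,v)$ over $Q\subset X$ with $|Q|=\lfloor |X|/2\rfloor$ (bipartition). For $T\subseteq S$ let $\operatorname{div}_{k,\mathcal M}(T)$ be the maximum of $\operatorname{div}(X)$ over independent $X\subseteq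 T$ with $|X|=k$. For $0<\beta\le 1$, a set $T\subseteq S$ is a $\beta$-*coreset* if it contains an independent set of size $k$ and $\operatorname{div}_{k,\mathcal M}(T)\ge\beta\operatorname{div}_{k,\mathcal M}(S)$. The *doubling dimension* of $S$ is the smallest $D$ such that every ball of $S$ is covered by at most $2^D$ balls of $S$ of half its radius (balls are closed and centered at points of $S$). **Algorithm StreamCoreset** with parameters $k,\varepsilon,c$ on a stream $x_1,\dots,x_n$ listing $S$ without repetition. Initially $R=d(x_1,x_2)$, $Z=\{x_1,x_2\}$, $D_{x_1}=\{x_1\}$, $D_{x_2}=\{x_2\}$. For $i\ge3$: 1. Let $z$ be a point of $Z$ closest to $x_i$. If $d(x_i,z)>2\varepsilon R/(ck)$, add $x_i$ to $Z$ and set $D_{x_i}=\{x_i\}$; otherwise call Handle$(x_i,z)$. 2. If $d(x_i,x_1)>2R$, set $R=d(x_i,x_1)$, choose a maximal $Z'\subseteq Z$ with pairwise distances greater than $\varepsilon R/(ck)$, and, for each $z\in Z\setminus Z'$, call Handle$(x,z')$ for each $x\in D_z$, where $z'$ is a point of $Z'$ closest to $z$; each such $x$ is taken out of $D_z$. Then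 set $Z=Z'$. At the end return $T=\bigcup_{z\in Z}D_z$. Handle$(x,z)$ discards $x$ if $D_z$ is an independent set of size $k$. Otherwise: for a partition matroid, $x$ is added to $D_z$ iff $D_z\cup\{x\}$ is independent; for a transversal matroid, $x$ is added iff some category $A$ of $x$ has $|A\cap D_z|<k$; for other matroids, $x$ is always added. In the last two cases, if $D_z$, after $x$ was added, contains an independent set of size $k$, then $D_z$ is replaced by such a set. Ties, the maximal set $Z'$, the order of the loops, and the independent set that is kept are chosen arbitrarily. **Theorem.** Let $0<\varepsilon<1$ and $c=32$, and consider any execution of StreamCoreset. The execution terminates, and the returned set $T=\bigcup_{z\in Z}D_z$ is a $(1-\varepsilon)$-coreset for each of the five diversity functions and for each matroid type. The algorithm makes a single pass over the stream, and at every moment its working memory is $O(|T|)$ words, where $T=\bigcup_{z\in Z}D_z$ denotes the union of the delegate sets at that moment and the implied constant depends only on $\gamma$. If $S$ has doubling dimension at most a constant $D$, then, at every moment and in particular for the returned set, $|T|=O(k(k/\varepsilon)^D)$ for a partition matroid and $|T|=O(k^2(k/\varepsilon)^D)$ for a transversal matroid, with implied constants depending only on $D$ and $\gamma$. (Here a number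 and a point take one word each, a point taking one further word for each category that contains it; the distance, independence and category oracles take no memory.) -/

import Mathlib

namespace StreamDMMC

/-! ### Matroids -/

/-- The type of a matroid constraint, together with the data that the description of such a
matroid consists of: the categories `A i` and, for a partition matroid, the bounds `b i`. -/
inductive MatroidKind (α : Type*) where
  | partition (h : ℕ) (A : Fin h → Finset α) (b : Fin h → ℕ)
  | transversal (h : ℕ) (A : Fin h → Finset α)
  | other

/-- `M` is the partition matroid on `S` with categories `A i` and cardinality bounds `b i`. -/
structure IsPartitionMatroid {α : Type*} [DecidableEq α] (M : Matroid α) (S : Finset α) {h : ℕ}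
    (A : Fin h → Finset α) (b : Fin h → ℕ) : Prop where
  ground : M.E = ↑S
  disjoint : ∀ i j, i ≠ j → Disjoint (A i) (A j)
  cover : Finset.univ.biUnion A = S
  bound_le : ∀ i, b i ≤ (A i).card
  indep_iff : ∀ X : Finset α, M.Indep (↑X : Set α) ↔ X ⊆ S ∧ ∀ i, (X ∩ A i).card ≤ b i

/-- `M` is the transversal matroid on `S` of the covering family `A i`: a set is independent iff
it can be matched into the categories, each element to a category that contains it. -/
structure IsTransversalMatroid {α : Type*} [DecidableEq α] (M : Matroid α) (S : Finset α) {h : ℕ}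
    (A : Fin h → Finset α) : Prop where
  ground : M.E = ↑S
  cover : Finset.univ.biUnion A = S
  indep_iff : ∀ X : Finset α, M.Indep (↑X : Set α) ↔
    X ⊆ S ∧ ∃ f : {x // x ∈ X} → Fin h, Function.Injective f ∧ ∀ x, x.1 ∈ A (f x)

/-- `M` is a matroid on `S` of the given type; for `other`, it may be any matroid on `S`. -/
def MatroidKind.Describes {α : Type*} [DecidableEq α] (κ : MatroidKind α) (M : Matroid α)
    (S : Finset α) : Prop :=
  match κ with
  | .partition _ A b => IsPartitionMatroid M S A b
  | .transversal _ A => IsTransversalMatroid M S A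
  | .other => M.E = ↑S

/-- The number of categories of the point `x`. -/
def MatroidKind.numCategories {α : Type*} [DecidableEq α] (κ : MatroidKind α) (x : α) : ℕ :=
  match κ with
  | .partition _ A _ => (Finset.univ.filter fun i => x ∈ A i).card
  | .transversal _ A => (Finset.univ.filter fun i => x ∈ A i).card
  | .other => 0

/-- For a transversal matroid, every point of `S` belongs to at most `γ` categories. -/
def MatroidKind.BoundedOverlap {α : Type*} [DecidableEq α] (κ : MatroidKind α) (S : Finset α)
    (γ : ℕ) : Prop :=
  match κ with
  | .transversal h A => ∀ x ∈ S, (MatroidKind.transversal h A).numCategories x ≤ γ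
  | _ => True

/-! ### Diversity functions, optimal diversity, coresets -/

/-- The five diversity functions. -/
inductive DiversityKind where
  | sum | star | tree | cycle | bipartition

/-- The length of an edge of the complete graph on the points. -/
def edgeLength {α : Type*} [MetricSpace α] : Sym2 α → ℝ :=
  Sym2.lift ⟨fun u v => dist u v, fun u v => dist_comm u v⟩

/-- The sum of the distances over all unordered pairs of points of `X`. -/
noncomputable def sumDiv {α : Type*} [MetricSpace α] (X : Finset α) : ℝ :=
  (∑ u ∈ X, ∑ v ∈ X, dist u v) / 2

/-- The smallest weight of a star on `X`. -/
noncomputable def starDiv {α : Type*} [MetricSpace α] [DecidableEq α] (X : Finset α) : ℝ :=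
  ⨅ c : {c // c ∈ X}, ∑ u ∈ X.erase c.1, dist c.1 u

open Classical in
/-- The smallest weight of a spanning tree of the complete graph on `X`. -/
noncomputable def treeDiv {α : Type*} [MetricSpace α] (X : Finset α) : ℝ :=
  ⨅ G : {G : SimpleGraph {x // x ∈ X} // G.IsTree},
    ∑ e ∈ G.1.edgeFinset, edgeLength (e.map Subtype.val)

/-- The smallest length of a closed tour through all points of `X`; the tour `σ` visits `σ 0`,
`σ 1`, and so on, and returns to `σ 0`, so that for two points their distance counts twice. -/
noncomputable def cycleDiv {α : Type*} [MetricSpace α] (X : Finset α) : ℝ :=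
  ⨅ σ : Fin X.card ≃ {x // x ∈ X}, ∑ i, dist (σ i).1 (σ (finRotate X.card i)).1

/-- The smallest weight of a balanced cut of `X`. -/
noncomputable def bipartitionDiv {α : Type*} [MetricSpace α] [DecidableEq α]
    (X : Finset α) : ℝ :=
  ⨅ Q : {Q // Q ∈ X.powersetCard (X.card / 2)}, ∑ u ∈ Q.1, ∑ v ∈ X \ Q.1, dist u v

/-- The diversity of `X`, for each of the five diversity functions. -/
noncomputable def diversity {α : Type*} [MetricSpace α] [DecidableEq α] (δ : DiversityKind)
    (X : Finset α) : ℝ :=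
  match δ with
  | .sum => sumDiv X
  | .star => starDiv X
  | .tree => treeDiv X
  | .cycle => cycleDiv X
  | .bipartition => bipartitionDiv X

/-- The feasible solutions inside `T`: the independent subsets of `T` of size `k`. -/
def feasible {α : Type*} (M : Matroid α) (k : ℕ) (T : Finset α) : Set (Finset α) :=
  {X | X ⊆ T ∧ M.Indep (↑X : Set α) ∧ X.card = k}

/-- The largest diversity of a feasible solution inside `T` (the maximum of finitely many values;
meaningful when there is a feasible solution). -/
noncomputable def optDiversity {α : Type*} [MetricSpace α] [DecidableEq α] (δ : DiversityKind)
    (M : Matroid α) (k : ℕ) (T : Finset α) : ℝ :=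
  sSup (diversity δ '' feasible M k T)

/-- `T ⊆ S` is a `β`-coreset: it contains a feasible solution, and its optimal diversity is at
least `β` times the optimal diversity of `S`. -/
structure IsCoreset {α : Type*} [MetricSpace α] [DecidableEq α] (δ : DiversityKind)
    (M : Matroid α) (k : ℕ) (β : ℝ) (S T : Finset α) : Prop where
  subset : T ⊆ S
  nonempty : (feasible M k T).Nonempty
  ratio : β * optDiversity δ M k S ≤ optDiversity δ M k T

/-- The matroid side of an input: a matroid `M` on `S` of type `κ` in which all singletons are
independent, and a positive integer `k` that is at most the rank of `M`. -/
structure IsInput {α : Type*} [DecidableEq α] (M : Matroid α) (κ : MatroidKind α) (S : Finset α)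
    (k : ℕ) : Prop where
  ground : M.E = ↑S
  kind : κ.Describes M S
  singleton : ∀ x ∈ S, M.Indep {x}
  pos : 1 ≤ k
  le_rank : (k : ℕ∞) ≤ M.eRank

/-! ### Doubling dimension -/

/-- Every ball of `S` can be covered by at most `2 ^ D` balls of `S` of half its radius. -/
def HalvesBalls {α : Type*} [MetricSpace α] (S : Finset α) (D : ℝ) : Prop :=
  ∀ x ∈ S, ∀ r : ℝ, 0 ≤ r → ∃ Y ⊆ S, (Y.card : ℝ) ≤ (2 : ℝ) ^ D ∧
    ∀ y ∈ S, dist y x ≤ r → ∃ c ∈ Y, dist y c ≤ r / 2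

/-- The doubling dimension of `S`. -/
noncomputable def doublingDimension {α : Type*} [MetricSpace α] (S : Finset α) : ℝ :=
  sInf {D : ℝ | HalvesBalls S D}

/-! ### The streaming algorithm -/

/-- `z` is a point of `W` closest to `x`. -/
def IsClosest {α : Type*} [MetricSpace α] (W : Finset α) (x z : α) : Prop :=
  z ∈ W ∧ ∀ w ∈ W, dist x z ≤ dist x w

/-- `W'` is an inclusion-maximal subset of `W` whose points are pairwise at distance more
than `t`. -/
def IsMaximalSeparated {α : Type*} [MetricSpace α] (t : ℝ) (W W' : Finset α) : Prop :=
  Maximal (fun V : Finset α => V ⊆ W ∧ ∀ u ∈ V, ∀ v ∈ V, u ≠ v → t < dist u v) W'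

/-- If `F` contains an independent set of size `k`, then `E` is such a set, otherwise `E = F`. -/
def Truncates {α : Type*} (M : Matroid α) (k : ℕ) (F E : Finset α) : Prop :=
  E ∈ feasible M k F ∨ (feasible M k F = ∅ ∧ E = F)

open Classical in
/-- The procedure Handle: `E'` is a possible new value of the delegate set `E` after handling the
point `x`. -/
def Handles {α : Type*} [DecidableEq α] (M : Matroid α) (κ : MatroidKind α) (k : ℕ)
    (E : Finset α) (x : α) (E' : Finset α) : Prop :=
  if E.card = k ∧ M.Indep (↑E : Set α) then E' = E
  else match κ with
    | .partition _ _ _ =>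
        if M.Indep (↑(insert x E) : Set α) then E' = insert x E else E' = E
    | .transversal _ A =>
        if ∃ i, x ∈ A i ∧ (A i ∩ E).card < k then Truncates M k (insert x E) E' else E' = E
    | .other => Truncates M k (insert x E) E'

/-- The control state of the algorithm, with the local variables that are live in it. -/
inductive Control (α : Type*) where
  /-- waiting for the next point of the stream -/
  | ready
  /-- the point `x` has been read and is to be placed -/
  | place (x : α)
  /-- the point `x` has been placed; the diameter estimate is to be checked against it -/
  | check (x : α)
  /-- restructuring: the centers outside `Z'` are being eliminated -/
  | merge (Z' : Finset α)
  /-- restructuring: the delegates of the center `z` are being handed over to `z' ∈ Z'` -/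
  | move (Z' : Finset α) (z z' : α)

/-- The content of the working memory: the first point of the stream, the diameter estimate `R`,
the set `Z` of centers, the delegate set `D z` of each center `z ∈ Z`, and the control state. -/
structure Memory (α : Type*) where
  first : α
  R : ℝ
  Z : Finset α
  D : α → Finset α
  ctrl : Control α

/-- The memory after the initial instructions, which read the first two points. -/
noncomputable def Memory.init {α : Type*} [MetricSpace α] [DecidableEq α] (x₁ x₂ : α) :
    Memory α where
  first := x₁
  R := dist x₁ x₂
  Z := {x₁, x₂}
  D := fun z => if z = x₁ ∨ z = x₂ then {z} else ∅
  ctrl := .ready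

/-- The union of the current delegate sets; at the end of the stream, it is the output. -/
def Memory.delegates {α : Type*} [DecidableEq α] (m : Memory α) : Finset α :=
  m.Z.biUnion m.D

/-- The number of memory words for the local variables of a control state; `w x` is the number of
words that the point `x` takes. -/
def Control.words {α : Type*} (w : α → ℕ) : Control α → ℕ
  | .ready => 0
  | .place x => w x
  | .check x => w x
  | .merge Z' => ∑ z ∈ Z', w z
  | .move Z' z z' => ∑ u ∈ Z', w u + w z + w z'

/-- The size of the working memory in words: one word for the number `R`, and for every stored copy
of a point one word for the point and one for each of its categories. -/
def Memory.words {α : Type*} [DecidableEq α] (κ : MatroidKind α) (m : Memory α) : ℕ :=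
  let w : α → ℕ := fun x => 1 + κ.numCategories x
  w m.first + 1 + ∑ z ∈ m.Z, w z + ∑ z ∈ m.Z, ∑ x ∈ m.D z, w x + m.ctrl.words w

/-- The steps of StreamCoreset with parameters `k`, `ε`, `c`. A step labelled `some x` takes `x`
from the stream as its next point; a step labelled `none` only uses the working memory. All choices
that the algorithm leaves open (ties, the maximal subset, the order of the loops, the independent
set that is kept) are left open here. -/
inductive Step {α : Type*} [MetricSpace α] [DecidableEq α] (M : Matroid α) (κ : MatroidKind α)
    (k : ℕ) (ε c : ℝ) : Memory α → Option α → Memory α → Prop where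
  | read (m : Memory α) (x : α) (h : m.ctrl = .ready) :
      Step M κ k ε c m (some x) { m with ctrl := .place x }
  | newCenter (m : Memory α) (x z : α) (h : m.ctrl = .place x) (hz : IsClosest m.Z x z)
      (hd : 2 * ε * m.R / (c * k) < dist x z) :
      Step M κ k ε c m none
        { m with Z := insert x m.Z, D := Function.update m.D x {x}, ctrl := .check x }
  | delegate (m : Memory α) (x z : α) (E : Finset α) (h : m.ctrl = .place x)
      (hz : IsClosest m.Z x z) (hd : dist x z ≤ 2 * ε * m.R / (c * k))
      (hE : Handles M κ k (m.D z) x E) :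
      Step M κ k ε c m none { m with D := Function.update m.D z E, ctrl := .check x }
  | keepEstimate (m : Memory α) (x : α) (h : m.ctrl = .check x)
      (hd : dist x m.first ≤ 2 * m.R) :
      Step M κ k ε c m none { m with ctrl := .ready }
  | newEstimate (m : Memory α) (x : α) (Z' : Finset α) (h : m.ctrl = .check x)
      (hd : 2 * m.R < dist x m.first)
      (hZ' : IsMaximalSeparated (ε * dist x m.first / (c * k)) m.Z Z') :
      Step M κ k ε c m none { m with R := dist x m.first, ctrl := .merge Z' }
  | pickCenter (m : Memory α) (Z' : Finset α) (z z' : α) (h : m.ctrl = .merge Z')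
      (hz : z ∈ m.Z \ Z') (hz' : IsClosest Z' z z') :
      Step M κ k ε c m none { m with ctrl := .move Z' z z' }
  | moveDelegate (m : Memory α) (Z' : Finset α) (z z' x : α) (E : Finset α)
      (h : m.ctrl = .move Z' z z') (hx : x ∈ m.D z) (hE : Handles M κ k (m.D z') x E) :
      Step M κ k ε c m none
        { m with D := Function.update (Function.update m.D z ((m.D z).erase x)) z' E }
  | dropCenter (m : Memory α) (Z' : Finset α) (z z' : α) (h : m.ctrl = .move Z' z z')
      (hz : m.D z = ∅) :
      Step M κ k ε c m none { m with Z := m.Z.erase z, ctrl := .merge Z' }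
  | mergeDone (m : Memory α) (Z' : Finset α) (h : m.ctrl = .merge Z') (hZ : m.Z \ Z' = ∅) :
      Step M κ k ε c m none { m with Z := Z', ctrl := .ready }

/-- `Exec M κ k ε c ys m`: an execution of StreamCoreset can be in memory state `m` at a moment when
exactly the points `ys` of the stream have been read, each of them once, in this order. -/
inductive Exec {α : Type*} [MetricSpace α] [DecidableEq α] (M : Matroid α) (κ : MatroidKind α)
    (k : ℕ) (ε c : ℝ) : List α → Memory α → Prop where
  | init (x₁ x₂ : α) : Exec M κ k ε c [x₁, x₂] (Memory.init x₁ x₂)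
  | internal (ys : List α) (m m' : Memory α) (h : Exec M κ k ε c ys m)
      (hs : Step M κ k ε c m none m') : Exec M κ k ε c ys m'
  | next (ys : List α) (x : α) (m m' : Memory α) (h : Exec M κ k ε c ys m)
      (hs : Step M κ k ε c m (some x) m') : Exec M κ k ε c (ys ++ [x]) m'

/-- The execution on the stream `xs` returns `T`: after one pass over `xs`, the algorithm asks for a
further point, and `T` is the union of its delegate sets. -/
def Returns {α : Type*} [MetricSpace α] [DecidableEq α] (M : Matroid α) (κ : MatroidKind α)
    (k : ℕ) (ε c : ℝ) (xs : List α) (T : Finset α) : Prop :=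
  ∃ m, Exec M κ k ε c xs m ∧ m.ctrl = .ready ∧ m.delegates = T

/-- No execution on the stream `xs` gets stuck or runs forever: at every moment the algorithm is
ready for the next point or can make a step on its working memory, and there is no infinite
sequence of steps on the working memory alone. -/
def Terminates {α : Type*} [MetricSpace α] [DecidableEq α] (M : Matroid α) (κ : MatroidKind α)
    (k : ℕ) (ε c : ℝ) (xs : List α) : Prop :=
  ∀ ys m, ys <+: xs → Exec M κ k ε c ys m →
    (m.ctrl = .ready ∨ ∃ m', Step M κ k ε c m none m') ∧
      Acc (fun m₂ m₁ => Step M κ k ε c m₁ none m₂) m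

end StreamDMMC

open StreamDMMC

/-!
The coreset property rests on a purely matroidal notion. A set `D` *dominates* a cluster `C` if, in
every independent set of size `k`, the elements of `C` can be exchanged for equally many elements of
`D ⊆ C` (`Dominates`). Domination is reflexive, transitive and additive over disjoint clusters, and
every call of Handle produces a delegate set that dominates the old delegate set together with the
handled point (`Handles.dominates`), for each type of matroid: an independent set of size `k`
dominates all its supersets, by augmentation; a point that cannot be added to an independent set
lies in its span and can be exchanged for one of its elements; and a point whose categories all
contain `k` delegates can be exchanged for a delegate that takes over its category. So no history of
the discarded points is needed: during an execution, each delegate set dominates its cluster, where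
the clusters have radius at most `2 * ε * R / (32 * k)` (`Invariant`). The radius survives a change
of the estimate because `R` more than doubles. While the delegates of `z` are being moved to `z'`,
the union of both delegate sets dominates the union of both clusters.

Exchanging cluster after cluster turns an optimal solution into a solution inside the delegate sets
(`exists_substitution`), and every distance changes by at most `ε * R / (4 * k)`. The distance `R`
occurs in `S`, and then some feasible solution contains two points at distance at least `R / 2`
(`exists_feasible_dist`). Already this makes each of the five diversities so large
(`le_diversity`) that the changes, added up over all distances that the diversity counts
(`diversity_le`), amount to at most a fraction `ε` of the optimum (`isCoreset_of_dominates`).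

For the space bounds, the delegate sets are disjoint, and all but at most one of them are nonempty,
so the number of centers is at most one more than the number of delegates (`Invariant.words_le`).
At every moment the centers, up to one, lie in a ball around the first point whose radius is
`64 * k / ε` times their spacing, which bounds their number by the doubling dimension
(`Invariant.card_centers_le_rpow`). A delegate set has at most `k` points for a partition matroid.
For a transversal matroid, its points can be charged to categories, at most `k` to each; if `k` or
more categories are charged, then there is an independent set of size `k`, to which the set is cut
down, so it has at most `k ^ 2` points (`Chargeable.card_le`).
-/

namespace StreamDMMC

section Matroids

variable {α : Type*}

/-! ### Domination: delegate sets that can replace a cluster -/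

/-- A smaller independent set `I` can be enlarged to the size of an independent set `J` by adding
elements of `J`. -/
theorem exists_subset_indep_union [DecidableEq α] {M : Matroid α} {J : Finset α}
    (hJ : M.Indep (↑J : Set α)) (n : ℕ) : ∀ I : Finset α, M.Indep (↑I : Set α) →
      I.card + n ≤ J.card →
      ∃ Y ⊆ J, Disjoint I Y ∧ Y.card = n ∧ M.Indep (↑(I ∪ Y) : Set α) := by
  induction n with
  | zero => exact fun I hI _ => ⟨∅, by simp, by simp, by simp, by simpa using hI⟩
  | succ n ih =>
    intro I hI hc
    obtain ⟨e, he, hIe⟩ := hI.exists_insert_of_encard_lt hJ (by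
      rw [Set.encard_coe_eq_coe_finsetCard, Set.encard_coe_eq_coe_finsetCard]
      exact_mod_cast (by omega : I.card < J.card))
    have heI : e ∉ I := fun h => he.2 (by simpa using h)
    obtain ⟨Y, hYJ, hd, hY, hind⟩ := ih (insert e I) (by simpa using hIe) (by
      rw [Finset.card_insert_of_notMem heI]; omega)
    rw [Finset.disjoint_insert_left] at hd
    refine ⟨insert e Y, Finset.insert_subset (by simpa using he.1) hYJ, ?_, ?_, ?_⟩
    · rw [Finset.disjoint_insert_right]; exact ⟨heI, hd.2⟩
    · rw [Finset.card_insert_of_notMem hd.1, hY]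
    · rwa [Finset.union_insert, ← Finset.insert_union]

/-- There is a feasible solution inside the ground set. -/
theorem exists_feasible {M : Matroid α} {S : Finset α} {k : ℕ} (hE : M.E = ↑S)
    (hk : (k : ℕ∞) ≤ M.eRank) : (feasible M k S).Nonempty := by
  obtain ⟨B, hB⟩ := M.exists_isBase
  have hBS : B ⊆ ↑S := hE ▸ hB.subset_ground
  lift B to Finset α using S.finite_toSet.subset hBS
  rw [← hB.encard_eq_eRank, Set.encard_coe_eq_coe_finsetCard] at hk
  obtain ⟨X, hXB, hX⟩ := Finset.exists_subset_card_eq (by exact_mod_cast hk : k ≤ B.card)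
  exact ⟨X, hXB.trans (by exact_mod_cast hBS), hB.indep.subset (by exact_mod_cast hXB), hX⟩

/-- `D` dominates the cluster `C`: in every independent set of size `k`, the elements of `C` can
be replaced by equally many elements of `D ⊆ C`, and the set stays independent. -/
structure Dominates [DecidableEq α] (M : Matroid α) (k : ℕ) (D C : Finset α) : Prop where
  subset : D ⊆ C
  exchange : ∀ X : Finset α, M.Indep (↑X : Set α) → X.card = k →
    ∃ Y ⊆ D, Y.card = (X ∩ C).card ∧ M.Indep (↑(X \ C ∪ Y) : Set α)

section Dominates

variable [DecidableEq α] {M : Matroid α} {k : ℕ} {C C' D D' E E' : Finset α}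

theorem Dominates.refl (M : Matroid α) (k : ℕ) (C : Finset α) : Dominates M k C C :=
  ⟨subset_rfl, fun X hX _ => ⟨X ∩ C, Finset.inter_subset_right, rfl, by
    rwa [Finset.sdiff_union_inter]⟩⟩

theorem card_sdiff_union {X Y : Finset α} (hY : Y ⊆ C) (hc : Y.card = (X ∩ C).card) :
    (X \ C ∪ Y).card = X.card := by
  rw [Finset.card_union_of_disjoint (Finset.sdiff_disjoint.mono_right hY), hc,
    Finset.card_sdiff_add_card_inter]

theorem Dominates.trans (h : Dominates M k D C) (h' : Dominates M k D' D) :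
    Dominates M k D' C := by
  refine ⟨h'.subset.trans h.subset, fun X hX hk => ?_⟩
  obtain ⟨Y, hY, hc, hi⟩ := h.exchange X hX hk
  obtain ⟨Y', hY', hc', hi'⟩ := h'.exchange _ hi
    ((card_sdiff_union (hY.trans h.subset) hc).trans hk)
  have h1 : (X \ C ∪ Y) ∩ D = Y := by
    ext x; have := @hY x; have := @h.subset x; grind
  have h2 : (X \ C ∪ Y) \ D = X \ C := by
    ext x; have := @hY x; have := @h.subset x; grind
  rw [h1] at hc'; rw [h2] at hi'
  exact ⟨Y', hY', hc'.trans hc, hi'⟩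

theorem Dominates.union (h : Dominates M k D C) (h' : Dominates M k D' C')
    (hd : Disjoint C C') : Dominates M k (D ∪ D') (C ∪ C') := by
  refine ⟨Finset.union_subset_union h.subset h'.subset, fun X hX hk => ?_⟩
  obtain ⟨Y, hY, hc, hi⟩ := h.exchange X hX hk
  obtain ⟨Y', hY', hc', hi'⟩ := h'.exchange _ hi
    ((card_sdiff_union (hY.trans h.subset) hc).trans hk)
  have hdis : ∀ x ∈ C, x ∉ C' := fun x hx => Finset.disjoint_left.1 hd hx
  have h1 : (X \ C ∪ Y) ∩ C' = X ∩ C' := by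
    ext x; have := @hY x; have := @h.subset x; have := hdis x; grind
  have h2 : (X \ C ∪ Y) \ C' ∪ Y' = X \ (C ∪ C') ∪ (Y ∪ Y') := by
    ext x; have := @hY x; have := @h.subset x; have := hdis x; grind
  rw [h1] at hc'; rw [h2] at hi'
  refine ⟨Y ∪ Y', Finset.union_subset_union hY hY', ?_, hi'⟩
  rw [Finset.card_union_of_disjoint
    (hd.mono (hY.trans h.subset) (hY'.trans h'.subset)), hc, hc', Finset.inter_union_distrib_left,
    Finset.card_union_of_disjoint
    (hd.mono Finset.inter_subset_right Finset.inter_subset_right)]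

/-- An independent set of size `k` dominates each of its supersets. -/
theorem Dominates.of_card_eq (hDC : D ⊆ C) (hD : M.Indep (↑D : Set α)) (hk : D.card = k) :
    Dominates M k D C := by
  refine ⟨hDC, fun X hX hXk => ?_⟩
  have hs := Finset.card_sdiff_add_card_inter X C
  obtain ⟨Y, hY, -, hc, hi⟩ := exists_subset_indep_union hD (X ∩ C).card (X \ C)
    (hX.subset (by exact_mod_cast Finset.sdiff_subset)) (by omega)
  exact ⟨Y, hY, hc, hi⟩

/-- To dominate `insert x E` by `E`, it suffices to find a substitute for `x` in every independent
set of size `k` that contains `x`. -/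
theorem Dominates.of_insert {x : α} (hx : x ∉ E)
    (h : ∀ X : Finset α, M.Indep (↑X : Set α) → X.card = k → x ∈ X →
      ∃ e ∈ E, e ∉ X ∧ M.Indep (↑(insert e (X.erase x)) : Set α)) :
    Dominates M k E (insert x E) := by
  refine ⟨Finset.subset_insert _ _, fun X hX hk => ?_⟩
  by_cases hxX : x ∈ X
  · obtain ⟨e, heE, heX, hi⟩ := h X hX hk hxX
    refine ⟨insert e (X ∩ E), ?_, ?_, ?_⟩
    · exact Finset.insert_subset heE Finset.inter_subset_right
    · rw [Finset.inter_insert_of_mem hxX, Finset.card_insert_of_notMem (by simp [heX]),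
        Finset.card_insert_of_notMem (by simp [hx])]
    · convert hi using 2
      ext y; grind
  · refine ⟨X ∩ E, Finset.inter_subset_right, by rw [Finset.inter_insert_of_notMem hxX], ?_⟩
    convert hX using 2
    ext y; grind

/-- An independent set spans, hence dominates, any element that cannot be added to it. -/
theorem Dominates.of_not_indep_insert {x : α} (hE : M.Indep (↑E : Set α)) (hx : x ∈ M.E)
    (hdep : ¬ M.Indep (↑(insert x E) : Set α)) : Dominates M k E (insert x E) := by
  have hxE : x ∉ E := fun h => hdep (by rwa [Finset.insert_eq_of_mem h])
  refine .of_insert hxE fun X hX _ hxX => ?_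
  have hxcl : x ∈ M.closure ↑E := by
    by_contra hcl
    exact hdep (by simpa using ((hE.notMem_closure_iff hx).1 hcl).1)
  have hX' : M.Indep (↑(X.erase x) : Set α) :=
    hX.subset (by exact_mod_cast Finset.erase_subset _ _)
  have hxX' : x ∉ M.closure ↑(X.erase x) := by
    rw [hX'.notMem_closure_iff hx]
    refine ⟨?_, by simp⟩
    rwa [← Finset.coe_insert, Finset.insert_erase hxX]
  -- otherwise `x ∈ cl E ⊆ cl (X \ {x})`
  have : ∃ e ∈ E, e ∉ M.closure ↑(X.erase x) := by
    by_contra! hall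
    exact hxX' (M.closure_subset_closure_of_subset_closure (fun e he => hall e he) hxcl)
  obtain ⟨e, heE, he⟩ := this
  have heM : e ∈ M.E := hE.subset_ground heE
  have h2 := (hX'.notMem_closure_iff heM).1 he
  refine ⟨e, heE, fun heX => h2.2 ?_, by simpa using h2.1⟩
  have : e ≠ x := fun h => hxE (h ▸ heE)
  simp [heX, this]

/-- In a transversal matroid, a point each of whose categories contains `k` points of `E` is
dominated by `E`: some point of `E` can take over its category. -/
theorem Dominates.of_full_categories {S : Finset α} {h : ℕ} {A : Fin h → Finset α} {x : α}
    (hM : IsTransversalMatroid M S A) (hx : x ∉ E)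
    (hfull : ∀ i, x ∈ A i → k ≤ (A i ∩ E).card) : Dominates M k E (insert x E) := by
  refine .of_insert hx fun X hX hk hxX => ?_
  obtain ⟨hXS, f, hf, hfA⟩ := (hM.indep_iff X).1 hX
  have hlt : (X.erase x).card < (A (f ⟨x, hxX⟩) ∩ E).card := by
    have := hfull _ (hfA ⟨x, hxX⟩)
    have := Finset.card_erase_lt_of_mem hxX
    omega
  obtain ⟨e, he, heX⟩ := Finset.exists_mem_notMem_of_card_lt_card hlt
  rw [Finset.mem_inter] at he
  have hex : e ≠ x := fun h => hx (h ▸ he.2)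
  have heX' : e ∉ X := fun h => heX (Finset.mem_erase.2 ⟨hex, h⟩)
  refine ⟨e, he.2, heX', (hM.indep_iff _).2 ⟨?_, ?_⟩⟩
  · refine Finset.insert_subset ?_ ((Finset.erase_subset _ _).trans hXS)
    rw [← hM.cover, Finset.mem_biUnion]
    exact ⟨_, Finset.mem_univ _, he.1⟩
  · have hmem : ∀ y : {y // y ∈ insert e (X.erase x)}, y.1 ≠ e → y.1 ∈ X := by
      rintro ⟨y, hy⟩ hye
      rw [Finset.mem_insert] at hy
      exact Finset.mem_of_mem_erase (hy.resolve_left hye)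
    have hne : ∀ y : {y // y ∈ insert e (X.erase x)}, y.1 ≠ e → y.1 ≠ x := by
      rintro ⟨y, hy⟩ hye
      rw [Finset.mem_insert] at hy
      exact Finset.ne_of_mem_erase (hy.resolve_left hye)
    refine ⟨fun y => if hy : y.1 = e then f ⟨x, hxX⟩ else f ⟨y.1, hmem y hy⟩, ?_, ?_⟩
    · intro y y' hyy
      by_cases h1 : y.1 = e <;> by_cases h2 : y'.1 = e
      · exact Subtype.ext (h1.trans h2.symm)
      · simp only [h1, h2, dite_true, dite_false] at hyy
        exact absurd (congrArg Subtype.val (hf hyy)).symm (hne y' h2)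
      · simp only [h1, h2, dite_true, dite_false] at hyy
        exact absurd (congrArg Subtype.val (hf hyy)) (hne y h1)
      · simp only [h1, h2, dite_false] at hyy
        exact Subtype.ext (Subtype.mk.inj (hf hyy))
    · intro y
      by_cases h1 : y.1 = e
      · simp only [h1, dite_true]; exact he.1
      · simp only [h1, dite_false]; exact hfA _

end Dominates

/-! ### The procedure Handle -/

/-- Every point of `E` can be charged to one of its categories so that no category is charged more
than `k` times. -/
def Chargeable [DecidableEq α] {h : ℕ} (A : Fin h → Finset α) (k : ℕ) (E : Finset α) : Prop :=
  ∃ χ : α → Fin h, (∀ x ∈ E, x ∈ A (χ x)) ∧ ∀ i, (E.filter fun x => χ x = i).card ≤ k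

/-- The property of delegate sets, depending on the type of the matroid, that Handle maintains. -/
def IsDelegateSet [DecidableEq α] (M : Matroid α) (κ : MatroidKind α) (k : ℕ)
    (E : Finset α) : Prop :=
  match κ with
  | .partition _ _ _ => M.Indep (↑E : Set α) ∧ E.card ≤ k
  | .transversal _ A => Chargeable A k E ∧ E.card ≤ k ^ 2
  | .other => True

section Handle

variable [DecidableEq α] {M : Matroid α} {κ : MatroidKind α} {k : ℕ} {S E E' F : Finset α}

theorem Chargeable.mono {h : ℕ} {A : Fin h → Finset α} (hF : Chargeable A k F) (hEF : E ⊆ F) :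
    Chargeable A k E := by
  obtain ⟨χ, h1, h2⟩ := hF
  exact ⟨χ, fun x hx => h1 x (hEF hx), fun i =>
    (Finset.card_le_card (Finset.filter_subset_filter _ hEF)).trans (h2 i)⟩

theorem Chargeable.insert {h : ℕ} {A : Fin h → Finset α} (hE : Chargeable A k E) {x : α}
    {i : Fin h} (hx : x ∈ A i) (hi : (A i ∩ E).card < k) : Chargeable A k (insert x E) := by
  by_cases hxE : x ∈ E
  · rwa [Finset.insert_eq_of_mem hxE]
  obtain ⟨χ, h1, h2⟩ := hE
  have hne : ∀ y ∈ E, y ≠ x := fun y hy h => hxE (h ▸ hy)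
  refine ⟨Function.update χ x i, ?_, fun j => ?_⟩
  · intro y hy
    rcases Finset.mem_insert.1 hy with rfl | hy
    · simpa using hx
    · rw [Function.update_of_ne (hne y hy)]; exact h1 y hy
  · have hfil : (E.filter fun y => Function.update χ x i y = j) = E.filter fun y => χ y = j :=
      Finset.filter_congr fun y hy => by rw [Function.update_of_ne (hne y hy)]
    rw [Finset.filter_insert, hfil, Function.update_self]
    split_ifs with hij
    · subst hij
      refine (Finset.card_insert_le _ _).trans (Nat.succ_le_of_lt (lt_of_le_of_lt ?_ hi))
      refine Finset.card_le_card fun y hy => ?_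
      rw [Finset.mem_filter] at hy
      exact Finset.mem_inter.2 ⟨hy.2 ▸ h1 y hy.1, hy.1⟩
    · exact h2 j

/-- A chargeable set without an independent subset of size `k` has fewer than `k` charged
categories, since points charged to distinct categories are independent. -/
theorem Chargeable.card_le {h : ℕ} {A : Fin h → Finset α} (hM : IsTransversalMatroid M S A)
    (hE : Chargeable A k E) (hemp : feasible M k E = ∅) : E.card ≤ k ^ 2 := by
  obtain ⟨χ, h1, h2⟩ := hE
  have hJ : (E.image χ).card ≤ k := by
    by_contra! hlt
    obtain ⟨J, hJ, hJk⟩ := Finset.exists_subset_card_eq hlt.le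
    have hrep : ∀ i ∈ J, ∃ x ∈ E, χ x = i := fun i hi => Finset.mem_image.1 (hJ hi)
    have : Nonempty α := by
      obtain ⟨x, -⟩ := Finset.card_pos.1 (k.zero_le.trans_lt (hlt.trans_le Finset.card_image_le))
      exact ⟨x⟩
    choose! r hrE hr using hrep
    have hinj : Set.InjOn r ↑J := fun i hi j hj hij => by rw [← hr i hi, ← hr j hj, hij]
    have hsub : J.image r ⊆ E := Finset.image_subset_iff.2 hrE
    refine Set.eq_empty_iff_forall_notMem.1 hemp (J.image r) ⟨hsub, (hM.indep_iff _).2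
      ⟨fun y hy => ?_, fun y => χ y.1, fun y y' hyy => ?_, fun y => h1 _ (hsub y.2)⟩,
      (Finset.card_image_of_injOn hinj).trans hJk⟩
    · rw [← hM.cover, Finset.mem_biUnion]
      exact ⟨_, Finset.mem_univ _, h1 _ (hsub hy)⟩
    · obtain ⟨y, hy⟩ := y
      obtain ⟨y', hy'⟩ := y'
      obtain ⟨i, hi, rfl⟩ := Finset.mem_image.1 hy
      obtain ⟨j, hj, rfl⟩ := Finset.mem_image.1 hy'
      simp only [hr i hi, hr j hj] at hyy
      simp [hyy]
  calc E.card = ∑ i ∈ E.image χ, (E.filter fun x => χ x = i).card :=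
        Finset.card_eq_sum_card_image χ E
    _ ≤ ∑ i ∈ E.image χ, k := Finset.sum_le_sum fun i _ => h2 i
    _ ≤ k ^ 2 := by rw [Finset.sum_const, smul_eq_mul, sq]; exact Nat.mul_le_mul_right k hJ

theorem IsDelegateSet.mono (hF : IsDelegateSet M κ k F) (hEF : E ⊆ F) :
    IsDelegateSet M κ k E := by
  cases κ with
  | partition h A b =>
    exact ⟨hF.1.subset (by exact_mod_cast hEF), (Finset.card_le_card hEF).trans hF.2⟩
  | transversal h A => exact ⟨hF.1.mono hEF, (Finset.card_le_card hEF).trans hF.2⟩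
  | other => trivial

theorem IsDelegateSet.singleton (hin : IsInput M κ S k) {x : α} (hx : x ∈ S) :
    IsDelegateSet M κ k {x} := by
  cases κ with
  | partition h A b => exact ⟨by simpa using hin.singleton x hx, by simpa using hin.pos⟩
  | transversal h A =>
    have hM : IsTransversalMatroid M S A := hin.kind
    rw [← hM.cover, Finset.mem_biUnion] at hx
    obtain ⟨i, -, hi⟩ := hx
    refine ⟨⟨fun _ => i, by simpa using hi, fun j => ?_⟩, ?_⟩
    · exact (Finset.card_filter_le _ _).trans (by simpa using hin.pos)
    · simpa using Nat.one_le_pow 2 k hin.pos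
  | other => trivial

theorem Handles.exists (M : Matroid α) (κ : MatroidKind α) (k : ℕ) (E : Finset α) (x : α) :
    ∃ E', Handles M κ k E x E' := by
  have htr : ∀ F : Finset α, ∃ E', Truncates M k F E' := fun F => by
    rcases (feasible M k F).eq_empty_or_nonempty with h | ⟨X, hX⟩
    · exact ⟨F, .inr ⟨h, rfl⟩⟩
    · exact ⟨X, .inl hX⟩
  unfold Handles
  by_cases h1 : E.card = k ∧ M.Indep (↑E : Set α)
  · simp only [if_pos h1]; exact ⟨_, rfl⟩
  · simp only [if_neg h1]
    cases κ <;> simp only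
    · split_ifs <;> exact ⟨_, rfl⟩
    · split_ifs
      · exact htr _
      · exact ⟨_, rfl⟩
    · exact htr _

/-- The possible outcomes of Handle, with the reason for which each of them is sound. -/
theorem Handles.cases (hin : IsInput M κ S k) {x : α} (hx : x ∈ S)
    (hE : IsDelegateSet M κ k E) (h : Handles M κ k E x E') :
    (E' = E ∧ Dominates M k E (insert x E)) ∨
    (E' = insert x E ∧ IsDelegateSet M κ k E') ∨
    (E' ∈ feasible M k (insert x E) ∧ IsDelegateSet M κ k E') := by
  have hxM : x ∈ M.E := by rw [hin.ground]; exact hx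
  unfold Handles at h
  by_cases h1 : E.card = k ∧ M.Indep (↑E : Set α)
  · rw [if_pos h1] at h
    exact .inl ⟨h, .of_card_eq (Finset.subset_insert _ _) h1.2 h1.1⟩
  · rw [if_neg h1] at h
    cases κ with
    | partition n A b =>
      simp only at h
      split_ifs at h with h2
      · refine .inr (.inl ⟨h, h ▸ ⟨h2, ?_⟩⟩)
        have : E.card ≠ k := fun hk => h1 ⟨hk, hE.1⟩
        have := hE.2
        have := Finset.card_insert_le x E
        omega
      · exact .inl ⟨h, .of_not_indep_insert hE.1 hxM h2⟩
    | transversal n A =>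
      simp only at h
      split_ifs at h with h2
      · obtain ⟨i, hi, hik⟩ := h2
        have hch : Chargeable A k (insert x E) := hE.1.insert hi hik
        rcases h with hf | ⟨hf, rfl⟩
        · refine .inr (.inr ⟨hf, hch.mono hf.1, ?_⟩)
          rw [hf.2.2]
          exact Nat.le_self_pow two_ne_zero k
        · exact .inr (.inl ⟨rfl, hch, hch.card_le hin.kind hf⟩)
      · push Not at h2
        refine .inl ⟨h, ?_⟩
        by_cases hxE : x ∈ E
        · rw [Finset.insert_eq_of_mem hxE]; exact .refl _ _ _
        · exact .of_full_categories hin.kind hxE h2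
    | other =>
      rcases h with hf | ⟨hf, rfl⟩
      · exact .inr (.inr ⟨hf, trivial⟩)
      · exact .inr (.inl ⟨rfl, trivial⟩)

/-- Handle preserves domination, whatever the type of the matroid. -/
theorem Handles.dominates (hin : IsInput M κ S k) {x : α} (hx : x ∈ S)
    (hE : IsDelegateSet M κ k E) (h : Handles M κ k E x E') : Dominates M k E' (insert x E) := by
  rcases h.cases hin hx hE with ⟨rfl, h⟩ | ⟨rfl, -⟩ | ⟨h, -⟩
  · exact h
  · exact .refl _ _ _
  · exact .of_card_eq h.1 h.2.1 h.2.2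

theorem Handles.isDelegateSet (hin : IsInput M κ S k) {x : α} (hx : x ∈ S)
    (hE : IsDelegateSet M κ k E) (h : Handles M κ k E x E') : IsDelegateSet M κ k E' := by
  rcases h.cases hin hx hE with ⟨rfl, -⟩ | ⟨-, h⟩ | ⟨-, h⟩
  exacts [hE, h, h]

theorem Handles.nonempty (hin : IsInput M κ S k) {x : α} (hx : x ∈ S)
    (hE : IsDelegateSet M κ k E) (hne : E.Nonempty) (h : Handles M κ k E x E') :
    E'.Nonempty := by
  rcases h.cases hin hx hE with ⟨rfl, -⟩ | ⟨rfl, -⟩ | ⟨h, -⟩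
  · exact hne
  · exact Finset.insert_nonempty _ _
  · rw [← Finset.card_pos, h.2.2]; exact hin.pos

end Handle

end Matroids

section Diversities

variable {α : Type*} [MetricSpace α]

/-! ### The diversity functions: perturbation and lower bounds -/

/-- The factor by which a change of all distances can change the diversity of a set of size `k`:
an upper bound for the number of distances that the diversity adds up. -/
noncomputable def pairCount (δ : DiversityKind) (k : ℕ) : ℝ :=
  match δ with
  | .sum => (k : ℝ) ^ 2 / 2
  | .star => k
  | .tree => k
  | .cycle => k
  | .bipartition => (k / 2 : ℕ) * (k - (k / 2 : ℕ))

theorem pairCount_nonneg (δ : DiversityKind) (k : ℕ) : 0 ≤ pairCount δ k := by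
  have : ((k / 2 : ℕ) : ℝ) ≤ k := by exact_mod_cast Nat.div_le_self k 2
  cases δ <;> simp only [pairCount] <;> positivity

@[simp] theorem edgeLength_mk (u v : α) : edgeLength s(u, v) = dist u v := rfl

theorem edgeLength_nonneg (e : Sym2 α) : 0 ≤ edgeLength e := by
  induction e using Sym2.ind with
  | _ u v => exact dist_nonneg

theorem exists_isTree (V : Type*) [Nonempty V] : ∃ G : SimpleGraph V, G.IsTree := by
  obtain ⟨T, -, hT⟩ := (SimpleGraph.connected_top (V := V)).exists_isTree_le
  exact ⟨T, hT⟩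

/-- The index type of the tours may be replaced by `Fin n` when `n` equals the cardinality; this
makes the tours of two sets of the same cardinality comparable. -/
theorem cycleDiv_eq {X : Finset α} {n : ℕ} (h : X.card = n) :
    cycleDiv X = ⨅ σ : Fin n ≃ {x // x ∈ X}, ∑ i, dist (σ i).1 (σ (finRotate n i)).1 := by
  subst h; rfl

section Perturbation

variable {X X' : Finset α} {t : ℝ}

theorem sumDiv_le (e : {x // x ∈ X} ≃ {x // x ∈ X'})
    (h : ∀ u v, dist u.1 v.1 ≤ dist (e u).1 (e v).1 + t) :
    sumDiv X ≤ sumDiv X' + (X.card : ℝ) ^ 2 / 2 * t := by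
  have key : ∑ u ∈ X, ∑ v ∈ X, dist u v ≤
      ∑ u ∈ X', ∑ v ∈ X', dist u v + (X.card : ℝ) ^ 2 * t := by
    calc ∑ u ∈ X, ∑ v ∈ X, dist u v
        = ∑ u : {x // x ∈ X}, ∑ v : {x // x ∈ X}, dist u.1 v.1 := by
          rw [← Finset.sum_coe_sort X]
          exact Finset.sum_congr rfl fun u _ => (Finset.sum_coe_sort X _).symm
      _ ≤ ∑ u : {x // x ∈ X}, ∑ v : {x // x ∈ X}, (dist (e u).1 (e v).1 + t) :=
          Finset.sum_le_sum fun u _ => Finset.sum_le_sum fun v _ => h u v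
      _ = ∑ u : {x // x ∈ X}, ∑ v : {x // x ∈ X}, dist (e u).1 (e v).1
            + (X.card : ℝ) ^ 2 * t := by
          simp [Finset.sum_add_distrib]; ring
      _ = ∑ u ∈ X', ∑ v ∈ X', dist u v + (X.card : ℝ) ^ 2 * t := by
          congr 1
          rw [← Finset.sum_coe_sort X', ← e.sum_comp]
          exact Finset.sum_congr rfl fun u _ => by
            rw [← Finset.sum_coe_sort X', ← e.sum_comp]
  unfold sumDiv
  linarith

theorem star_eq [DecidableEq α] {c : α} : ∑ u ∈ X.erase c, dist c u =
    ∑ u : {x // x ∈ X}, dist c u.1 := by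
  rw [Finset.sum_erase _ (dist_self c), Finset.sum_coe_sort X (fun u => dist c u)]

theorem starDiv_le [DecidableEq α] (hX : X.Nonempty) (e : {x // x ∈ X} ≃ {x // x ∈ X'})
    (h : ∀ u v, dist u.1 v.1 ≤ dist (e u).1 (e v).1 + t) :
    starDiv X ≤ starDiv X' + X.card * t := by
  obtain ⟨x, hx⟩ := hX
  have : Nonempty {x // x ∈ X'} := ⟨e ⟨x, hx⟩⟩
  rw [← sub_le_iff_le_add]
  refine le_ciInf fun c => ?_
  rw [sub_le_iff_le_add, star_eq]
  refine (ciInf_le (Set.finite_range _).bddBelow (e.symm c)).trans ?_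
  rw [star_eq]
  calc ∑ u : {x // x ∈ X}, dist (e.symm c).1 u.1
      ≤ ∑ u : {x // x ∈ X}, (dist c.1 (e u).1 + t) :=
        Finset.sum_le_sum fun u _ => by simpa using h (e.symm c) u
    _ = ∑ u : {x // x ∈ X}, dist c.1 (e u).1 + X.card * t := by
        simp [Finset.sum_add_distrib]
    _ = _ := by rw [e.sum_comp (fun u => dist c.1 u.1)]

open Classical in
/-- A spanning tree is transported along the bijection; it has fewer edges than `X` has points. -/
theorem treeDiv_le (hX : X.Nonempty) (ht : 0 ≤ t) (e : {x // x ∈ X} ≃ {x // x ∈ X'})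
    (h : ∀ u v, dist u.1 v.1 ≤ dist (e u).1 (e v).1 + t) :
    treeDiv X ≤ treeDiv X' + X.card * t := by
  obtain ⟨x, hx⟩ := hX
  have : Nonempty {x // x ∈ X'} := ⟨e ⟨x, hx⟩⟩
  obtain ⟨G₀, hG₀⟩ := exists_isTree {x // x ∈ X'}
  have : Nonempty {G : SimpleGraph {x // x ∈ X'} // G.IsTree} := ⟨⟨G₀, hG₀⟩⟩
  rw [← sub_le_iff_le_add]
  refine le_ciInf fun G => ?_
  rw [sub_le_iff_le_add]
  have hT : (G.1.comap e).IsTree := (SimpleGraph.Iso.comap e G.1).isTree_iff.2 G.2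
  refine (ciInf_le (Set.finite_range _).bddBelow ⟨G.1.comap e, hT⟩).trans ?_
  simp only
  have hcard : ((G.1.comap e).edgeFinset.card : ℝ) ≤ X.card := by
    have := hT.card_edgeFinset
    rw [Fintype.card_coe] at this
    exact_mod_cast (by omega : (G.1.comap e).edgeFinset.card ≤ X.card)
  calc ∑ a ∈ (G.1.comap e).edgeFinset, edgeLength (a.map Subtype.val)
      ≤ ∑ a ∈ (G.1.comap e).edgeFinset, (edgeLength ((a.map e).map Subtype.val) + t) := by
        refine Finset.sum_le_sum fun a _ => ?_
        induction a using Sym2.ind with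
        | _ u v => simpa using h u v
    _ = ∑ a ∈ (G.1.comap e).edgeFinset, edgeLength ((a.map e).map Subtype.val)
          + (G.1.comap e).edgeFinset.card * t := by
        rw [Finset.sum_add_distrib, Finset.sum_const, nsmul_eq_mul]
    _ ≤ ∑ a ∈ G.1.edgeFinset, edgeLength (a.map Subtype.val) + X.card * t := by
        refine add_le_add (le_of_eq ?_) (mul_le_mul_of_nonneg_right hcard ht)
        refine Finset.sum_bij (fun a _ => a.map e) ?_ ?_ ?_ (fun _ _ => rfl)
        · intro a ha
          induction a using Sym2.ind with
          | _ u v => simpa using ha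
        · intro a _ b _ hab
          exact Sym2.map.injective e.injective hab
        · intro b hb
          induction b using Sym2.ind with
          | _ u v => exact ⟨s(e.symm u, e.symm v), by simpa using hb, by simp⟩

theorem cycleDiv_le (e : {x // x ∈ X} ≃ {x // x ∈ X'})
    (h : ∀ u v, dist u.1 v.1 ≤ dist (e u).1 (e v).1 + t) :
    cycleDiv X ≤ cycleDiv X' + X.card * t := by
  have hc : X'.card = X.card := by simpa using (Fintype.card_congr e).symm
  have : Nonempty (Fin X.card ≃ {x // x ∈ X'}) := ⟨(X'.equivFinOfCardEq hc).symm⟩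
  rw [cycleDiv_eq hc, ← sub_le_iff_le_add]
  refine le_ciInf fun σ => ?_
  rw [sub_le_iff_le_add]
  refine (ciInf_le (Set.finite_range _).bddBelow (σ.trans e.symm)).trans ?_
  calc ∑ i, dist ((σ.trans e.symm) i).1 ((σ.trans e.symm) (finRotate X.card i)).1
      ≤ ∑ i, (dist (σ i).1 (σ (finRotate X.card i)).1 + t) :=
        Finset.sum_le_sum fun i _ => by
          simpa using h (e.symm (σ i)) (e.symm (σ (finRotate X.card i)))
    _ = _ := by simp [Finset.sum_add_distrib]

theorem bipartitionDiv_le [DecidableEq α] (e : {x // x ∈ X} ≃ {x // x ∈ X'})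
    (h : ∀ u v, dist u.1 v.1 ≤ dist (e u).1 (e v).1 + t) :
    bipartitionDiv X ≤ bipartitionDiv X' +
      (X.card / 2 : ℕ) * (X.card - (X.card / 2 : ℕ)) * t := by
  have hc : X'.card = X.card := by simpa using (Fintype.card_congr e).symm
  obtain ⟨Q₀, hQ₀⟩ := Finset.powersetCard_nonempty.2 (Nat.div_le_self X'.card 2)
  have : Nonempty {Q // Q ∈ X'.powersetCard (X'.card / 2)} := ⟨⟨Q₀, hQ₀⟩⟩
  rw [← sub_le_iff_le_add]
  refine le_ciInf fun Q => ?_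
  rw [sub_le_iff_le_add]
  obtain ⟨Q, hQ⟩ := Q
  rw [Finset.mem_powersetCard, hc] at hQ
  obtain ⟨hQX, hQc⟩ := hQ
  -- the inverse of `e`, as a function on all points
  let g : α → α := fun x => if hx : x ∈ X' then (e.symm ⟨x, hx⟩).1 else x
  have hg : ∀ x (hx : x ∈ X'), g x = (e.symm ⟨x, hx⟩).1 := fun x hx => dif_pos hx
  have hgX : ∀ x ∈ X', g x ∈ X := fun x hx => by rw [hg x hx]; exact Subtype.prop _
  have hinj : Set.InjOn g ↑X' := by
    intro x hx y hy hxy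
    rw [hg x hx, hg y hy] at hxy
    simpa using hxy
  have hQg : Q.image g ⊆ X := fun y hy => by
    obtain ⟨x, hx, rfl⟩ := Finset.mem_image.1 hy
    exact hgX x (hQX hx)
  have hQgc : (Q.image g).card = X.card / 2 := by
    rw [Finset.card_image_of_injOn (hinj.mono (by exact_mod_cast hQX)), hQc]
  have himg : X'.image g = X := Finset.eq_of_subset_of_card_le
    (fun y hy => by obtain ⟨x, hx, rfl⟩ := Finset.mem_image.1 hy; exact hgX x hx)
    (by rw [Finset.card_image_of_injOn hinj, hc])
  have hcompl : X \ Q.image g = (X' \ Q).image g := by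
    rw [← himg]
    ext y
    simp only [Finset.mem_sdiff, Finset.mem_image]
    constructor
    · rintro ⟨⟨x, hx, rfl⟩, hy⟩
      exact ⟨x, ⟨hx, fun h => hy ⟨x, h, rfl⟩⟩, rfl⟩
    · rintro ⟨x, ⟨hx, hxQ⟩, rfl⟩
      refine ⟨⟨x, hx, rfl⟩, ?_⟩
      rintro ⟨y, hy, hyx⟩
      exact hxQ (hinj (hQX hy) hx hyx ▸ hy)
  have hbdd : BddBelow (Set.range fun Q : {Q // Q ∈ X.powersetCard (X.card / 2)} =>
    ∑ u ∈ Q.1, ∑ v ∈ X \ Q.1, dist u v) := (Set.finite_range _).bddBelow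
  refine (ciInf_le hbdd ⟨Q.image g, Finset.mem_powersetCard.2 ⟨hQg, hQgc⟩⟩).trans ?_
  simp only
  rw [hcompl, Finset.sum_image (hinj.mono (by exact_mod_cast hQX))]
  calc ∑ u ∈ Q, ∑ v ∈ (X' \ Q).image g, dist (g u) v
      ≤ ∑ u ∈ Q, ∑ v ∈ X' \ Q, (dist u v + t) := by
        refine Finset.sum_le_sum fun u hu => ?_
        rw [Finset.sum_image (hinj.mono (by exact_mod_cast Finset.sdiff_subset))]
        refine Finset.sum_le_sum fun v hv => ?_
        rw [hg u (hQX hu), hg v (Finset.sdiff_subset hv)]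
        simpa using h (e.symm ⟨u, hQX hu⟩) (e.symm ⟨v, Finset.sdiff_subset hv⟩)
    _ = _ := by
        simp only [Finset.sum_add_distrib, Finset.sum_const, nsmul_eq_mul]
        rw [Finset.card_sdiff_of_subset hQX, hQc, hc, Nat.cast_sub (Nat.div_le_self _ _)]
        ring

/-- If a bijection shrinks no distance by more than `t`, the diversity drops by at most
`pairCount δ k * t`. -/
theorem diversity_le [DecidableEq α] (δ : DiversityKind) {k : ℕ} (hk : X.card = k) (hpos : 1 ≤ k)
    (ht : 0 ≤ t)
    (e : {x // x ∈ X} ≃ {x // x ∈ X'}) (h : ∀ u v, dist u.1 v.1 ≤ dist (e u).1 (e v).1 + t) :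
    diversity δ X ≤ diversity δ X' + pairCount δ k * t := by
  subst hk
  have hX : X.Nonempty := Finset.card_pos.1 hpos
  cases δ with
  | sum => exact sumDiv_le e h
  | star => exact starDiv_le hX e h
  | tree => exact treeDiv_le hX ht e h
  | cycle => exact cycleDiv_le e h
  | bipartition => exact bipartitionDiv_le e h

end Perturbation

section LowerBound

variable {X : Finset α} {p q : α}

theorem dist_le_sum_dist [DecidableEq α] (c : α) (hp : p ∈ X) (hq : q ∈ X) (hpq : p ≠ q) :
    dist p q ≤ ∑ u ∈ X, dist c u :=
  calc dist p q ≤ ∑ u ∈ {p, q}, dist c u := by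
        rw [Finset.sum_pair hpq, dist_comm c p]; exact dist_triangle _ _ _
    _ ≤ _ := Finset.sum_le_sum_of_subset_of_nonneg
        (Finset.insert_subset hp (Finset.singleton_subset_iff.2 hq)) fun _ _ _ => dist_nonneg

theorem le_sumDiv [DecidableEq α] (hp : p ∈ X) (hq : q ∈ X) (hpq : p ≠ q) :
    X.card * dist p q ≤ 2 * sumDiv X := by
  have : ∑ u ∈ X, dist p q ≤ ∑ u ∈ X, ∑ v ∈ X, dist u v :=
    Finset.sum_le_sum fun u _ => dist_le_sum_dist u hp hq hpq
  rw [Finset.sum_const, nsmul_eq_mul] at this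
  unfold sumDiv
  linarith

theorem le_starDiv [DecidableEq α] (hp : p ∈ X) (hq : q ∈ X) (hpq : p ≠ q) :
    dist p q ≤ starDiv X := by
  have : Nonempty {x // x ∈ X} := ⟨⟨p, hp⟩⟩
  refine le_ciInf fun c => ?_
  rw [Finset.sum_erase _ (dist_self c.1)]
  exact dist_le_sum_dist c.1 hp hq hpq

theorem dist_le_sum_edges {G : SimpleGraph {x // x ∈ X}} {u v : {x // x ∈ X}} (w : G.Walk u v) :
    dist u.1 v.1 ≤ (w.edges.map fun e => edgeLength (e.map Subtype.val)).sum := by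
  induction w with
  | nil => simp
  | cons _ _ ih =>
    simp only [SimpleGraph.Walk.edges_cons, List.map_cons, List.sum_cons, Sym2.map_mk,
      edgeLength_mk]
    exact (dist_triangle _ _ _).trans (add_le_add le_rfl ih)

open Classical in
/-- A spanning tree contains a path from `p` to `q`. -/
theorem le_treeDiv (hp : p ∈ X) (hq : q ∈ X) : dist p q ≤ treeDiv X := by
  have : Nonempty {x // x ∈ X} := ⟨⟨p, hp⟩⟩
  obtain ⟨G₀, hG₀⟩ := exists_isTree {x // x ∈ X}
  have : Nonempty {G : SimpleGraph {x // x ∈ X} // G.IsTree} := ⟨⟨G₀, hG₀⟩⟩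
  refine le_ciInf fun G => ?_
  obtain ⟨w, hw⟩ := G.2.connected.exists_isPath ⟨p, hp⟩ ⟨q, hq⟩
  refine (dist_le_sum_edges w).trans ?_
  rw [← List.sum_toFinset _ hw.isTrail.edges_nodup]
  refine Finset.sum_le_sum_of_subset_of_nonneg (fun e he => ?_) fun e _ _ => edgeLength_nonneg _
  rw [SimpleGraph.mem_edgeFinset]
  exact w.edges_subset_edgeSet (List.mem_toFinset.1 he)

/-- A closed tour contains a path between `p` and `q`. -/
theorem le_cycleDiv (hp : p ∈ X) (hq : q ∈ X) : dist p q ≤ cycleDiv X := by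
  obtain ⟨n, hn⟩ : ∃ n, X.card = n + 1 :=
    ⟨X.card - 1, by have := Finset.card_pos.2 ⟨p, hp⟩; omega⟩
  rw [cycleDiv_eq hn]
  have : Nonempty (Fin (n + 1) ≃ {x // x ∈ X}) := ⟨(X.equivFinOfCardEq hn).symm⟩
  refine le_ciInf fun σ => ?_
  let g : ℕ → α := fun i => (σ (Fin.ofNat (n + 1) i)).1
  have hsum : ∑ i, dist (σ i).1 (σ (finRotate (n + 1) i)).1 =
      ∑ i ∈ Finset.range (n + 1), dist (g i) (g (i + 1)) := by
    rw [← Fin.sum_univ_eq_sum_range (fun i => dist (g i) (g (i + 1)))]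
    refine Finset.sum_congr rfl fun i _ => ?_
    have h1 : Fin.ofNat (n + 1) i.1 = i := by ext; simp [Fin.ofNat, Nat.mod_eq_of_lt i.2]
    have h2 : Fin.ofNat (n + 1) (i.1 + 1) = finRotate (n + 1) i := by
      rw [finRotate_apply]; ext; simp [Fin.ofNat, Fin.val_add]
    simp only [g, h1, h2]
  have key : ∀ a b : Fin (n + 1), a ≤ b → dist (σ a).1 (σ b).1 ≤
      ∑ i ∈ Finset.range (n + 1), dist (g i) (g (i + 1)) := by
    intro a b hab
    have hg : ∀ i : Fin (n + 1), g i.1 = (σ i).1 := fun i => by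
      have h1 : Fin.ofNat (n + 1) i.1 = i := by ext; simp [Fin.ofNat, Nat.mod_eq_of_lt i.2]
      simp only [g, h1]
    rw [← hg a, ← hg b]
    refine (dist_le_Ico_sum_dist g (Fin.le_def.1 hab)).trans ?_
    refine Finset.sum_le_sum_of_subset_of_nonneg (fun i hi => ?_) fun _ _ _ => dist_nonneg
    rw [Finset.mem_Ico] at hi
    exact Finset.mem_range.2 (hi.2.trans b.2)
  rw [hsum]
  have hp' : p = (σ (σ.symm ⟨p, hp⟩)).1 := by simp
  have hq' : q = (σ (σ.symm ⟨q, hq⟩)).1 := by simp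
  rw [hp', hq']
  rcases le_total (σ.symm ⟨p, hp⟩) (σ.symm ⟨q, hq⟩) with h | h
  · exact key _ _ h
  · rw [dist_comm]; exact key _ _ h

/-- Any cut is heavy as soon as two points are distant, on whichever sides they lie. -/
theorem le_cut {Q P : Finset α} (hp : p ∈ Q ∨ p ∈ P) (hq : q ∈ Q ∨ q ∈ P) :
    Q.card * P.card * dist p q ≤
      2 * (Q.card + P.card : ℝ) * ∑ u ∈ Q, ∑ v ∈ P, dist u v := by
  set cut := ∑ u ∈ Q, ∑ v ∈ P, dist u v with hcut
  have hcomm : cut = ∑ v ∈ P, ∑ u ∈ Q, dist v u := by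
    rw [hcut, Finset.sum_comm]; simp only [dist_comm]
  have hrow : ∀ u ∈ Q, ∑ v ∈ P, dist u v ≤ cut := fun u hu =>
    Finset.single_le_sum (f := fun u => ∑ v ∈ P, dist u v)
      (fun _ _ => Finset.sum_nonneg fun _ _ => dist_nonneg) hu
  have hcol : ∀ v ∈ P, ∑ u ∈ Q, dist v u ≤ cut := fun v hv => by
    rw [hcomm]
    exact Finset.single_le_sum (f := fun v => ∑ u ∈ Q, dist v u)
      (fun _ _ => Finset.sum_nonneg fun _ _ => dist_nonneg) hv
  have hc0 : 0 ≤ cut := Finset.sum_nonneg fun _ _ => Finset.sum_nonneg fun _ _ => dist_nonneg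
  have hQ0 : (0 : ℝ) ≤ Q.card := Nat.cast_nonneg _
  have hP0 : (0 : ℝ) ≤ P.card := Nat.cast_nonneg _
  -- two points on the same side: each point of the other side is joined to both
  have same : ∀ A B : Finset α, (∀ u ∈ A, ∑ v ∈ B, dist u v ≤ cut) → p ∈ A → q ∈ A →
      B.card * dist p q ≤ 2 * cut := by
    intro A B hA hpA hqA
    have : ∑ v ∈ B, dist p q ≤ ∑ v ∈ B, (dist p v + dist q v) :=
      Finset.sum_le_sum fun v _ => by rw [dist_comm q v]; exact dist_triangle _ _ _
    rw [Finset.sum_const, nsmul_eq_mul, Finset.sum_add_distrib] at this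
    linarith [hA p hpA, hA q hqA]
  -- two points on different sides: sum the triangle inequality over all detours `p, v, u, q`
  have diff : ∀ a ∈ Q, ∀ b ∈ P, Q.card * P.card * dist a b ≤ (Q.card + P.card + 1) * cut := by
    intro a ha b hb
    have h1 : ∑ u ∈ Q, ∑ v ∈ P, dist a b ≤
        ∑ u ∈ Q, ∑ v ∈ P, (dist a v + dist u v + dist b u) :=
      Finset.sum_le_sum fun u _ => Finset.sum_le_sum fun v _ => by
        linarith [dist_triangle4 a v u b, dist_comm v u, dist_comm u b]
    simp only [Finset.sum_add_distrib, Finset.sum_const, nsmul_eq_mul, ← Finset.mul_sum] at h1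
    have h2 := mul_le_mul_of_nonneg_left (hrow a ha) hQ0
    have h3 := mul_le_mul_of_nonneg_left (hcol b hb) hP0
    rw [← hcut] at h1
    linarith
  have hcard : ∀ A : Finset α, ∀ x ∈ A, (1 : ℝ) ≤ A.card := fun A x hx => by
    exact_mod_cast Finset.card_pos.2 ⟨x, hx⟩
  rcases hp with hp | hp <;> rcases hq with hq | hq
  · have := mul_le_mul_of_nonneg_left (same Q P hrow hp hq) hQ0
    nlinarith [mul_nonneg hP0 hc0]
  · have := hcard Q p hp
    have := diff p hp q hq
    nlinarith [mul_nonneg hP0 hc0]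
  · have := hcard Q q hq
    have := diff q hq p hp
    rw [dist_comm q p] at this
    nlinarith [mul_nonneg hP0 hc0]
  · have := mul_le_mul_of_nonneg_left (same P Q hcol hp hq) hP0
    nlinarith [mul_nonneg hQ0 hc0]

theorem le_bipartitionDiv [DecidableEq α] (hp : p ∈ X) (hq : q ∈ X) :
    (X.card / 2 : ℕ) * (X.card - (X.card / 2 : ℕ)) * dist p q ≤
      2 * X.card * bipartitionDiv X := by
  have hc : (0 : ℝ) < 2 * X.card := by
    have : (0 : ℝ) < X.card := by exact_mod_cast Finset.card_pos.2 ⟨p, hp⟩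
    linarith
  obtain ⟨Q₀, hQ₀⟩ := Finset.powersetCard_nonempty.2 (Nat.div_le_self X.card 2)
  have : Nonempty {Q // Q ∈ X.powersetCard (X.card / 2)} := ⟨⟨Q₀, hQ₀⟩⟩
  rw [← div_le_iff₀' hc]
  refine le_ciInf fun Q => ?_
  obtain ⟨Q, hQ⟩ := Q
  rw [Finset.mem_powersetCard] at hQ
  obtain ⟨hQX, hQc⟩ := hQ
  rw [div_le_iff₀' hc]
  have hP : ((X \ Q).card : ℝ) = X.card - (X.card / 2 : ℕ) := by
    rw [Finset.card_sdiff_of_subset hQX, hQc, Nat.cast_sub (Nat.div_le_self _ _)]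
  have hside : ∀ x ∈ X, x ∈ Q ∨ x ∈ X \ Q := fun x hx => by
    by_cases h : x ∈ Q <;> simp [h, hx]
  have := le_cut (hside p hp) (hside q hq)
  rw [hP, hQc] at this
  simpa using this

/-- Two distant points already force a large diversity. -/
theorem le_diversity [DecidableEq α] (δ : DiversityKind) {k : ℕ} (hk : X.card = k) (hp : p ∈ X)
    (hq : q ∈ X)
    (hpq : p ≠ q) : pairCount δ k * dist p q ≤ 2 * k * diversity δ X := by
  subst hk
  have hc : (0 : ℝ) ≤ X.card := Nat.cast_nonneg _
  have hd : 0 ≤ dist p q := dist_nonneg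
  cases δ with
  | sum =>
    have := mul_le_mul_of_nonneg_left (le_sumDiv hp hq hpq) hc
    simp only [pairCount, diversity]
    nlinarith [mul_nonneg hc (mul_nonneg hc hd)]
  | star =>
    have := mul_le_mul_of_nonneg_left (le_starDiv hp hq hpq) hc
    simp only [pairCount, diversity]; nlinarith [mul_nonneg hc hd]
  | tree =>
    have := mul_le_mul_of_nonneg_left (le_treeDiv hp hq) hc
    simp only [pairCount, diversity]; nlinarith [mul_nonneg hc hd]
  | cycle =>
    have := mul_le_mul_of_nonneg_left (le_cycleDiv hp hq) hc
    simp only [pairCount, diversity]; nlinarith [mul_nonneg hc hd]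
  | bipartition => exact le_bipartitionDiv hp hq

end LowerBound

theorem diversity_nonneg [DecidableEq α] (δ : DiversityKind) (X : Finset α) :
    0 ≤ diversity δ X := by
  cases δ with
  | sum =>
    exact div_nonneg (Finset.sum_nonneg fun _ _ => Finset.sum_nonneg fun _ _ => dist_nonneg)
      zero_le_two
  | star => exact Real.iInf_nonneg fun _ => Finset.sum_nonneg fun _ _ => dist_nonneg
  | tree => exact Real.iInf_nonneg fun _ => Finset.sum_nonneg fun _ _ => edgeLength_nonneg _
  | cycle => exact Real.iInf_nonneg fun _ => Finset.sum_nonneg fun _ _ => dist_nonneg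
  | bipartition =>
    exact Real.iInf_nonneg fun _ => Finset.sum_nonneg fun _ _ =>
      Finset.sum_nonneg fun _ _ => dist_nonneg

end Diversities

section Coresets

/-! ### From delegate sets to coresets -/

variable {α : Type*}

/-- If every cluster is dominated by its delegate set, then each independent set of size `k` can be
moved into the delegate sets, every point to a delegate of its own cluster. The clusters are the
fibres of the proxy function `p`, and they are treated one after the other. -/
theorem exists_substitution [DecidableEq α] {M : Matroid α} {k : ℕ} {P : Finset α} {p : α → α}
    {D : α → Finset α} {X : Finset α} (hXP : X ⊆ P) (hX : M.Indep (↑X : Set α))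
    (hk : X.card = k) (Z : Finset α)
    (hD : ∀ z ∈ Z, Dominates M k (D z) (P.filter fun x => p x = z)) :
    ∃ f : α → α, Set.InjOn f ↑X ∧ M.Indep (↑(X.image f) : Set α) ∧
      ∀ x ∈ X, (p x ∈ Z → f x ∈ D (p x)) ∧ (p x ∉ Z → f x = x) := by
  induction Z using Finset.induction_on with
  | empty => exact ⟨id, Set.injOn_id _, by simpa using hX, by simp⟩
  | insert w Z hw ih =>
    obtain ⟨f, hinj, hind, hf⟩ := ih fun z hz => hD z (Finset.mem_insert_of_mem hz)
    have hDw := hD w (Finset.mem_insert_self w Z)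
    have hpD : ∀ z ∈ insert w Z, ∀ x ∈ D z, p x = z := fun z hz x hx =>
      (Finset.mem_filter.1 ((hD z hz).subset hx)).2
    have hpf : ∀ x ∈ X, p (f x) = p x := fun x hx => by
      by_cases h : p x ∈ Z
      · exact hpD _ (Finset.mem_insert_of_mem h) _ ((hf x hx).1 h)
      · rw [(hf x hx).2 h]
    have hcard : (X.image f).card = k := by rw [Finset.card_image_of_injOn hinj, hk]
    obtain ⟨Y, hY, hYc, hYi⟩ := hDw.exchange _ hind hcard
    have hfw : ∀ x ∈ X, p x = w → f x = x := fun x hx h => (hf x hx).2 (h ▸ hw)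
    have hint : X.image f ∩ P.filter (fun x => p x = w) = X.filter fun x => p x = w := by
      ext y
      simp only [Finset.mem_inter, Finset.mem_image, Finset.mem_filter]
      constructor
      · rintro ⟨⟨x, hx, rfl⟩, -, hy⟩
        rw [hpf x hx] at hy
        rw [hfw x hx hy]
        exact ⟨hx, hy⟩
      · rintro ⟨hy, hyw⟩
        exact ⟨⟨y, hy, hfw y hy hyw⟩, hXP hy, hyw⟩
    rw [hint] at hYc
    obtain ⟨g, hg⟩ : ∃ g : α → α, Set.BijOn g ↑(X.filter fun x => p x = w) ↑Y := by
      by_cases hne : Nonempty α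
      · exact (Finset.finite_toSet _).exists_bijOn_of_encard_eq
          (by simp only [Set.encard_coe_eq_coe_finsetCard, hYc])
      · rw [not_nonempty_iff] at hne
        exact ⟨id, fun x => hne.elim x, fun x => hne.elim x, fun x => hne.elim x⟩
    have hgY : ∀ x ∈ X, p x = w → g x ∈ Y := fun x hx h => by
      have := hg.mapsTo (show x ∈ ↑(X.filter fun x => p x = w) by simp [hx, h])
      simpa using this
    have hpg : ∀ x ∈ X, p x = w → p (g x) = w := fun x hx h =>
      hpD w (Finset.mem_insert_self _ _) _ (hY (hgY x hx h))
    refine ⟨fun x => if p x = w then g x else f x, ?_, ?_, fun x hx => ⟨fun h => ?_, fun h => ?_⟩⟩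
    · intro x hx y hy hxy
      simp only at hxy
      split_ifs at hxy with h1 h2 h2
      · exact hg.injOn (by simpa [h1] using hx) (by simpa [h2] using hy) hxy
      · exact absurd (by rw [← hpf y hy, ← hxy, hpg x hx h1]) h2
      · exact absurd (by rw [← hpf x hx, hxy, hpg y hy h2]) h1
      · exact hinj hx hy hxy
    · convert hYi using 2
      ext y
      simp only [Finset.mem_image, Finset.mem_union, Finset.mem_sdiff, Finset.mem_filter, not_and]
      constructor
      · rintro ⟨x, hx, rfl⟩
        split_ifs with h
        · exact .inr (hgY x hx h)
        · exact .inl ⟨⟨x, hx, rfl⟩, fun _ => by rwa [hpf x hx]⟩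
      · rintro (⟨⟨x, hx, rfl⟩, h⟩ | hy)
        · refine ⟨x, hx, if_neg fun hw => ?_⟩
          rw [hfw x hx hw] at h
          exact h (hXP hx) hw
        · obtain ⟨x, hx, rfl⟩ := hg.surjOn (Finset.mem_coe.2 hy)
          rw [Finset.mem_coe, Finset.mem_filter] at hx
          exact ⟨x, hx.1, if_pos hx.2⟩
    · by_cases hpw : p x = w
      · simp only [hpw]
        exact hY (hgY x hx hpw)
      · simp only [if_neg hpw]
        exact (hf x hx).1 ((Finset.mem_insert.1 h).resolve_left hpw)
    · rw [Finset.mem_insert, not_or] at h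
      simp only [if_neg h.1]
      exact (hf x hx).2 h.2

theorem finite_feasible (M : Matroid α) (k : ℕ) (S : Finset α) : (feasible M k S).Finite :=
  S.powerset.finite_toSet.subset fun _ hX => Finset.mem_coe.2 (Finset.mem_powerset.2 hX.1)

variable [MetricSpace α] [DecidableEq α] {M : Matroid α} {κ : MatroidKind α} {k : ℕ}
  {S T : Finset α}

theorem diversity_le_optDiversity (δ : DiversityKind) {X : Finset α} (hX : X ∈ feasible M k T) :
    diversity δ X ≤ optDiversity δ M k T :=
  le_csSup ((finite_feasible M k T).image _).bddAbove ⟨X, hX, rfl⟩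

theorem exists_diversity_eq_optDiversity (δ : DiversityKind) (h : (feasible M k S).Nonempty) :
    ∃ X ∈ feasible M k S, diversity δ X = optDiversity δ M k S :=
  (h.image _).csSup_mem ((finite_feasible M k S).image _)

/-- For `k ≥ 2`, some feasible solution contains two points at least half as far apart as two given
points `a`, `b`. A solution through `a` that lies near `a` is turned into one through `b` that
keeps a point near `a`. -/
theorem exists_feasible_dist (hin : IsInput M κ S k) (hk : 2 ≤ k) {a b : α} (ha : a ∈ S)
    (hb : b ∈ S) :
    ∃ X ∈ feasible M k S, ∃ p ∈ X, ∃ q ∈ X, p ≠ q ∧ dist a b / 2 ≤ dist p q := by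
  obtain ⟨B, hBS, hB, hBk⟩ := exists_feasible hin.ground hin.le_rank
  have extend : ∀ (x : α), x ∈ S → ∀ J : Finset α, M.Indep (↑J : Set α) → J ⊆ S → J.card = k →
      ∃ Y ⊆ J, x ∉ Y ∧ insert x Y ∈ feasible M k S ∧ Y.card = k - 1 := by
    intro x hx J hJ hJS hJk
    obtain ⟨Y, hYJ, hd, hYc, hYi⟩ := exists_subset_indep_union hJ (k - 1) {x}
      (by simpa using hin.singleton x hx) (by rw [Finset.card_singleton]; omega)
    rw [Finset.disjoint_singleton_left] at hd
    refine ⟨Y, hYJ, hd, ⟨Finset.insert_subset hx (hYJ.trans hJS), ?_, ?_⟩, hYc⟩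
    · rwa [Finset.insert_eq]
    · rw [Finset.card_insert_of_notMem hd]; omega
  obtain ⟨Y, -, haY, hY, hYc⟩ := extend a ha B hB hBS hBk
  by_cases hfar : ∃ q ∈ Y, dist a b / 2 ≤ dist a q
  · obtain ⟨q, hq, hd⟩ := hfar
    exact ⟨_, hY, a, Finset.mem_insert_self _ _, q, Finset.mem_insert_of_mem hq,
      fun h => haY (h ▸ hq), hd⟩
  · push Not at hfar
    obtain ⟨Y', hY', hbY', hF, hYc'⟩ := extend b hb _ hY.2.1 hY.1 hY.2.2
    obtain ⟨u, hu⟩ : Y'.Nonempty := Finset.card_pos.1 (by omega)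
    refine ⟨_, hF, b, Finset.mem_insert_self _ _, u, Finset.mem_insert_of_mem hu,
      fun h => hbY' (h ▸ hu), ?_⟩
    have : dist a u ≤ dist a b / 2 := by
      rcases Finset.mem_insert.1 (hY' hu) with rfl | h
      · rw [dist_self]; positivity
      · exact (hfar u h).le
    linarith [dist_triangle_right a b u]

/-- Delegate sets that dominate clusters of radius `2 * ε * R / (32 * k)` form a coreset when the
distance `R` occurs in `S`: replacing points by delegates costs `ε * R / (4 * k)` per distance. -/
theorem isCoreset_of_dominates (δ : DiversityKind) (hin : IsInput M κ S k) {ε R : ℝ}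
    (hε : 0 < ε) {a b : α} (ha : a ∈ S) (hb : b ∈ S) (hR : dist a b = R)
    {Z : Finset α} {D : α → Finset α} {p : α → α}
    (hp : ∀ x ∈ S, p x ∈ Z ∧ dist x (p x) ≤ 2 * ε * R / (32 * k))
    (hD : ∀ z ∈ Z, Dominates M k (D z) (S.filter fun x => p x = z)) :
    IsCoreset δ M k (1 - ε) S (Z.biUnion D) := by
  have hk0 : (0 : ℝ) < k := by exact_mod_cast hin.pos
  have hR0 : 0 ≤ R := hR ▸ dist_nonneg
  have key : ∀ X ∈ feasible M k S, ∃ X' ∈ feasible M k (Z.biUnion D),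
      ∃ e : {x // x ∈ X} ≃ {x // x ∈ X'}, ∀ x, dist x.1 (e x).1 ≤ ε * R / (8 * k) := by
    rintro X ⟨hXS, hX, hXk⟩
    obtain ⟨f, hinj, hind, hf⟩ := exists_substitution hXS hX hXk Z hD
    have hfD : ∀ x ∈ X, f x ∈ D (p x) := fun x hx => (hf x hx).1 (hp x (hXS hx)).1
    have hbij : Set.BijOn f ↑X ↑(X.image f) := by
      rw [Finset.coe_image]; exact hinj.bijOn_image
    refine ⟨X.image f, ⟨?_, hind, by rw [Finset.card_image_of_injOn hinj, hXk]⟩,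
      hbij.equiv f, fun x => ?_⟩
    · intro y hy
      obtain ⟨x, hx, rfl⟩ := Finset.mem_image.1 hy
      exact Finset.mem_biUnion.2 ⟨p x, (hp x (hXS hx)).1, hfD x hx⟩
    · obtain ⟨x, hx⟩ := x
      have hfx := Finset.mem_filter.1 ((hD _ (hp x (hXS hx)).1).subset (hfD x hx))
      have h1 := (hp x (hXS hx)).2
      have h2 := (hp (f x) hfx.1).2
      rw [hfx.2] at h2
      have h3 : ε * R / (8 * k) = 2 * ε * R / (32 * k) + 2 * ε * R / (32 * k) := by
        field_simp; ring
      change dist x (f x) ≤ _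
      rw [h3]
      linarith [dist_triangle_right x (f x) (p x)]
  refine ⟨?_, ?_, ?_⟩
  · intro x hx
    obtain ⟨z, hz, hx⟩ := Finset.mem_biUnion.1 hx
    exact (Finset.mem_filter.1 ((hD z hz).subset hx)).1
  · obtain ⟨X, hX⟩ := exists_feasible hin.ground hin.le_rank
    obtain ⟨X', hX', -⟩ := key X hX
    exact ⟨X', hX'⟩
  obtain ⟨X, hX, hopt⟩ :=
    exists_diversity_eq_optDiversity δ (exists_feasible hin.ground hin.le_rank)
  obtain ⟨X', hX', e, he⟩ := key X hX
  refine le_trans ?_ (diversity_le_optDiversity δ hX')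
  rw [← hopt]
  rcases Nat.lt_or_ge k 2 with hk | hk
  · -- a single point: no distance changes
    have hk1 : X.card = 1 := by have := hin.pos; have := hX.2.2; omega
    have hsub : ∀ u v : {x // x ∈ X}, u = v := fun u v =>
      Subtype.ext (Finset.card_le_one.1 hk1.le _ u.2 _ v.2)
    have := diversity_le δ hX.2.2 hin.pos le_rfl e fun u v => by rw [hsub u v]; simp
    nlinarith [diversity_nonneg δ X]
  · obtain ⟨X₀, hX₀, u, hu, v, hv, huv, hd⟩ := exists_feasible_dist hin hk ha hb
    have h1 := diversity_le δ hX.2.2 hin.pos (t := ε * R / (4 * k)) (by positivity) e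
      fun u v => by
        have h3 : ε * R / (4 * k) = ε * R / (8 * k) + ε * R / (8 * k) := by
          field_simp; ring
        rw [h3]
        linarith [dist_triangle4 u.1 (e u).1 (e v).1 v.1, he u, he v, dist_comm (e v).1 v.1]
    have h2 := le_diversity δ hX₀.2.2 hu hv huv
    have h3 : diversity δ X₀ ≤ diversity δ X := hopt ▸ diversity_le_optDiversity δ hX₀
    have hN := pairCount_nonneg δ k
    rw [hR] at hd
    have h4 : pairCount δ k * (ε * R / (4 * k)) ≤ ε * diversity δ X := by
      have : pairCount δ k * (R / 2) ≤ 2 * k * diversity δ X :=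
        (mul_le_mul_of_nonneg_left hd hN).trans
          (h2.trans (mul_le_mul_of_nonneg_left h3 (by positivity)))
      calc pairCount δ k * (ε * R / (4 * k)) = ε / (2 * k) * (pairCount δ k * (R / 2)) := by
            field_simp; norm_num
        _ ≤ ε / (2 * k) * (2 * k * diversity δ X) :=
            mul_le_mul_of_nonneg_left this (by positivity)
        _ = ε * diversity δ X := by field_simp
    linarith

end Coresets

section Clusterings

/-! ### Clusterings and their updates -/

variable {α : Type*} [DecidableEq α] {M : Matroid α} {κ : MatroidKind α} {k : ℕ}
  {S P Z Z' E : Finset α} {D D' : α → Finset α} {p : α → α} {rad rad' : α → ℝ} {x z z' : α}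

/-- The proxy function `p` assigns the points of `P` to the centers in `Z`, at distance at most
`rad z` from the center `z`, and every `D z` dominates the cluster of `z`. -/
structure Clustering [MetricSpace α] (M : Matroid α) (k : ℕ) (rad : α → ℝ) (P Z : Finset α)
    (D : α → Finset α) (p : α → α) : Prop where
  mem : ∀ x ∈ P, p x ∈ Z
  dist_le : ∀ x ∈ P, dist x (p x) ≤ rad (p x)
  dominates : ∀ z ∈ Z, Dominates M k (D z) (P.filter fun x => p x = z)

section Clustering

theorem filter_update_insert (hx : x ∉ P) (w : α) :
    ((insert x P).filter fun y => Function.update p x z y = w) =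
      if w = z then insert x (P.filter fun y => p y = z) else P.filter fun y => p y = w := by
  have h : (P.filter fun y => Function.update p x z y = w) = P.filter fun y => p y = w :=
    Finset.filter_congr fun y hy => by
      rw [Function.update_of_ne fun h : y = x => hx (h ▸ hy)]
  rw [Finset.filter_insert, h, Function.update_self]
  by_cases hw : w = z
  · simp [hw]
  · simp [hw, Ne.symm hw]

variable [MetricSpace α]

theorem Clustering.mono (h : Clustering M k rad P Z D p) (hr : ∀ z ∈ Z, rad z ≤ rad' z) :
    Clustering M k rad' P Z D p :=
  ⟨h.mem, fun x hx => (h.dist_le x hx).trans (hr _ (h.mem x hx)), h.dominates⟩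

theorem Clustering.trans (h : Clustering M k rad P Z D p)
    (hD : ∀ z ∈ Z, Dominates M k (D' z) (D z)) : Clustering M k rad P Z D' p :=
  ⟨h.mem, h.dist_le, fun z hz => (h.dominates z hz).trans (hD z hz)⟩

/-- A new point joins the cluster of `z`. -/
theorem Clustering.insertPoint (h : Clustering M k rad P Z D p) (hx : x ∉ P) (hz : z ∈ Z)
    (hd : dist x z ≤ rad z) (hE : Dominates M k E (insert x (D z))) :
    Clustering M k rad (insert x P) Z (Function.update D z E) (Function.update p x z) := by
  refine ⟨fun y hy => ?_, fun y hy => ?_, fun w hw => ?_⟩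
  · by_cases hyx : y = x
    · subst hyx; rwa [Function.update_self]
    · rw [Function.update_of_ne hyx]; exact h.mem y (Finset.mem_of_mem_insert_of_ne hy hyx)
  · by_cases hyx : y = x
    · subst hyx; rwa [Function.update_self]
    · rw [Function.update_of_ne hyx]; exact h.dist_le y (Finset.mem_of_mem_insert_of_ne hy hyx)
  · rw [filter_update_insert hx]
    split_ifs with hwz
    · subst hwz
      rw [Function.update_self, Finset.insert_eq]
      refine Dominates.trans (((Dominates.refl M k {x}).union (h.dominates w hw) ?_)) ?_
      · simp [hx]
      · rwa [← Finset.insert_eq]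
    · rw [Function.update_of_ne hwz]; exact h.dominates w hw

/-- A new point becomes a center. -/
theorem Clustering.insertCenter (h : Clustering M k rad P Z D p) (hx : x ∉ P) (hxZ : x ∉ Z)
    (hr : 0 ≤ rad x) :
    Clustering M k rad (insert x P) (insert x Z) (Function.update D x {x})
      (Function.update p x x) := by
  refine ⟨fun y hy => ?_, fun y hy => ?_, fun w hw => ?_⟩
  · by_cases hyx : y = x
    · subst hyx; rw [Function.update_self]; exact Finset.mem_insert_self _ _
    · rw [Function.update_of_ne hyx]
      exact Finset.mem_insert_of_mem (h.mem y (Finset.mem_of_mem_insert_of_ne hy hyx))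
  · by_cases hyx : y = x
    · subst hyx; rwa [Function.update_self, dist_self]
    · rw [Function.update_of_ne hyx]; exact h.dist_le y (Finset.mem_of_mem_insert_of_ne hy hyx)
  · rw [filter_update_insert hx]
    split_ifs with hwx
    · subst hwx
      have : (P.filter fun y => p y = w) = ∅ :=
        Finset.filter_eq_empty_iff.2 fun y hy hyw => hxZ (hyw ▸ h.mem y hy)
      rw [Function.update_self, this]
      exact .refl _ _ _
    · rw [Function.update_of_ne hwx]
      exact h.dominates w (Finset.mem_of_mem_insert_of_ne hw hwx)

/-- The cluster of `z` is absorbed by the cluster of `z'`. -/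
theorem Clustering.absorb (h : Clustering M k rad P Z D p) (hz : z ∈ Z) (hz' : z' ∈ Z)
    (hne : z' ≠ z) (hd : rad z + dist z z' ≤ rad z') :
    Clustering M k rad P (Z.erase z) (Function.update D z' (D z' ∪ D z))
      fun x => if p x = z then z' else p x := by
  refine ⟨fun y hy => ?_, fun y hy => ?_, fun w hw => ?_⟩
  · split_ifs with hyz
    · exact Finset.mem_erase.2 ⟨hne, hz'⟩
    · exact Finset.mem_erase.2 ⟨hyz, h.mem y hy⟩
  · have := h.dist_le y hy
    split_ifs with hyz
    · rw [hyz] at this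
      linarith [dist_triangle y z z']
    · exact this
  · obtain ⟨hwz, hw⟩ := Finset.mem_erase.1 hw
    by_cases hwz' : w = z'
    · subst hwz'
      rw [Function.update_self]
      have : (P.filter fun y => (if p y = z then w else p y) = w) =
          (P.filter fun y => p y = w) ∪ P.filter fun y => p y = z := by
        ext y; simp only [Finset.mem_filter, Finset.mem_union]; grind
      rw [this]
      refine (h.dominates w hw).union (h.dominates z hz) ?_
      exact Finset.disjoint_filter.2 fun y _ h1 h2 => hne (h1.symm.trans h2)
    · rw [Function.update_of_ne hwz']
      have : (P.filter fun y => (if p y = z then z' else p y) = w) =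
          P.filter fun y => p y = w :=
        Finset.filter_congr fun y _ => by grind
      rw [this]
      exact h.dominates w hw

end Clustering

/-! ### Delegate sets and their updates -/

/-- The delegate sets `D z` of the centers `z ∈ Z` are disjoint subsets of `P` of the kind that
Handle maintains. -/
structure DelegateInvariant (M : Matroid α) (κ : MatroidKind α) (k : ℕ) (P Z : Finset α)
    (D : α → Finset α) : Prop where
  centers : Z ⊆ P
  subset : ∀ z ∈ Z, D z ⊆ P
  disjoint : ∀ z ∈ Z, ∀ w ∈ Z, z ≠ w → Disjoint (D z) (D w)
  isDelegateSet : ∀ z ∈ Z, IsDelegateSet M κ k (D z)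

theorem DelegateInvariant.mono (h : DelegateInvariant M κ k P Z D) (hZ : Z' ⊆ Z) :
    DelegateInvariant M κ k P Z' D :=
  ⟨hZ.trans h.centers, fun z hz => h.subset z (hZ hz),
    fun z hz w hw => h.disjoint z (hZ hz) w (hZ hw), fun z hz => h.isDelegateSet z (hZ hz)⟩

theorem DelegateInvariant.erase (h : DelegateInvariant M κ k P Z D) (z x : α) :
    DelegateInvariant M κ k P Z (Function.update D z ((D z).erase x)) := by
  have hsub : ∀ w, Function.update D z ((D z).erase x) w ⊆ D w := fun w => by
    by_cases hw : w = z
    · subst hw; rw [Function.update_self]; exact Finset.erase_subset _ _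
    · rw [Function.update_of_ne hw]
  exact ⟨h.centers, fun w hw => (hsub w).trans (h.subset w hw),
    fun w hw v hv hwv => (h.disjoint w hw v hv hwv).mono (hsub w) (hsub v),
    fun w hw => (h.isDelegateSet w hw).mono (hsub w)⟩

/-- Handle is called for a point that is in no other delegate set. -/
theorem DelegateInvariant.handle (hin : IsInput M κ S k) (h : DelegateInvariant M κ k P Z D)
    (hx : x ∈ S) (hz : z ∈ Z) (hnew : ∀ w ∈ Z, w ≠ z → x ∉ D w)
    (hE : Handles M κ k (D z) x E) :
    DelegateInvariant M κ k (insert x P) Z (Function.update D z E) := by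
  have hsub := (hE.dominates hin hx (h.isDelegateSet z hz)).subset
  have hdis : ∀ w ∈ Z, w ≠ z → Disjoint E (D w) := fun w hw hwz =>
    Disjoint.mono_left hsub (Finset.disjoint_insert_left.2
      ⟨hnew w hw hwz, h.disjoint z hz w hw hwz.symm⟩)
  refine ⟨h.centers.trans (Finset.subset_insert _ _), fun w hw => ?_, fun w hw v hv hwv => ?_,
    fun w hw => ?_⟩
  · by_cases hwz : w = z
    · subst hwz
      rw [Function.update_self]
      exact hsub.trans (Finset.insert_subset_insert _ (h.subset w hw))
    · rw [Function.update_of_ne hwz]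
      exact (h.subset w hw).trans (Finset.subset_insert _ _)
  · by_cases hwz : w = z
    · subst hwz
      rw [Function.update_self, Function.update_of_ne hwv.symm]
      exact hdis v hv hwv.symm
    · rw [Function.update_of_ne hwz]
      by_cases hvz : v = z
      · subst hvz
        rw [Function.update_self]
        exact (hdis w hw hwz).symm
      · rw [Function.update_of_ne hvz]
        exact h.disjoint w hw v hv hwv
  · by_cases hwz : w = z
    · subst hwz
      rw [Function.update_self]
      exact hE.isDelegateSet hin hx (h.isDelegateSet w hw)
    · rw [Function.update_of_ne hwz]
      exact h.isDelegateSet w hw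

theorem DelegateInvariant.insertCenter (hin : IsInput M κ S k)
    (h : DelegateInvariant M κ k P Z D) (hx : x ∈ S) (hxP : x ∉ P) :
    DelegateInvariant M κ k (insert x P) (insert x Z) (Function.update D x {x}) := by
  have hne : ∀ w ∈ Z, w ≠ x := fun w hw hwx => hxP (hwx ▸ h.centers hw)
  have hdis : ∀ w ∈ Z, x ∉ D w := fun w hw hxw => hxP (h.subset w hw hxw)
  refine ⟨Finset.insert_subset_insert _ h.centers, fun w hw => ?_, fun w hw v hv hwv => ?_,
    fun w hw => ?_⟩
  · rcases Finset.mem_insert.1 hw with rfl | hw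
    · rw [Function.update_self]
      exact Finset.singleton_subset_iff.2 (Finset.mem_insert_self _ _)
    · rw [Function.update_of_ne (hne w hw)]
      exact (h.subset w hw).trans (Finset.subset_insert _ _)
  · rcases Finset.mem_insert.1 hw with hwx | hw' <;> rcases Finset.mem_insert.1 hv with hvx | hv'
    · exact absurd (hwx.trans hvx.symm) hwv
    · rw [hwx, Function.update_self, Function.update_of_ne (hne v hv')]
      exact Finset.disjoint_singleton_left.2 (hdis v hv')
    · rw [hvx, Function.update_self, Function.update_of_ne (hne w hw')]
      exact Finset.disjoint_singleton_right.2 (hdis w hw')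
    · rw [Function.update_of_ne (hne w hw'), Function.update_of_ne (hne v hv')]
      exact h.disjoint w hw' v hv' hwv
  · rcases Finset.mem_insert.1 hw with rfl | hw
    · rw [Function.update_self]; exact .singleton hin hx
    · rw [Function.update_of_ne (hne w hw)]; exact h.isDelegateSet w hw

end Clusterings

section Executions

/-! ### The invariant of an execution -/

variable {α : Type*} [MetricSpace α] [DecidableEq α] {M : Matroid α} {κ : MatroidKind α} {k : ℕ}
  {S P Z : Finset α} {ε : ℝ} {m m' : Memory α}

/-- The points of `V` are pairwise at distance more than `t`. -/
def IsSeparated (t : ℝ) (V : Finset α) : Prop :=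
  ∀ u ∈ V, ∀ v ∈ V, u ≠ v → t < dist u v

/-- The separation of the centers that belongs to the estimate `R`. -/
noncomputable def spacing (ε : ℝ) (k : ℕ) (R : ℝ) : ℝ := ε * R / (32 * k)

theorem two_mul_spacing (ε : ℝ) (k : ℕ) (R : ℝ) :
    2 * ε * R / (32 * k) = 2 * spacing ε k R := by
  unfold spacing; ring

/-- The state between restructurings: the clusters have radius twice the spacing and no delegate
set is empty. -/
structure Settled (M : Matroid α) (k : ℕ) (ε : ℝ) (P : Finset α) (m : Memory α) : Prop where
  nonempty : ∀ z ∈ m.Z, (m.D z).Nonempty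
  clustering : ∃ p, Clustering M k (fun _ => 2 * spacing ε k m.R) P m.Z m.D p
  separated : IsSeparated (spacing ε k m.R) m.Z

/-- The properties, during a restructuring, of the set `Z'` of centers that remain. -/
structure Restructuring (k : ℕ) (ε : ℝ) (P : Finset α) (m : Memory α) (Z' : Finset α) :
    Prop where
  subset : Z' ⊆ m.Z
  nonempty : Z'.Nonempty
  separated : IsSeparated (spacing ε k m.R) Z'
  near : ∀ z ∈ m.Z, ∃ z' ∈ Z', dist z z' ≤ spacing ε k m.R
  ball : ∀ x ∈ P, dist x m.first ≤ 2 * m.R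

/-- The radius of the clusters during a restructuring: the clusters that are still to be merged
into others have half the final radius. -/
noncomputable def mergeRadius (ε : ℝ) (k : ℕ) (R : ℝ) (Z' : Finset α) (z : α) : ℝ :=
  if z ∈ Z' then 2 * spacing ε k R else spacing ε k R

/-- The part of the invariant that depends on the control state. While the delegates of `z` are
moved to `z'`, the cluster of `z` already counts as part of that of `z'`, and the union of both
delegate sets serves it. -/
def ControlInvariant (M : Matroid α) (k : ℕ) (ε : ℝ) (S P : Finset α) (m : Memory α) : Prop :=
  match m.ctrl with
  | .ready => Settled M k ε P m ∧ ∀ y ∈ P, dist y m.first ≤ 2 * m.R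
  | .place x => Settled M k ε P m ∧ (∀ y ∈ P, dist y m.first ≤ 2 * m.R) ∧ x ∈ S ∧ x ∉ P
  | .check x => Settled M k ε P m ∧ (∀ y ∈ P, y ≠ x → dist y m.first ≤ 2 * m.R) ∧ x ∈ P
  | .merge Z' => Restructuring k ε P m Z' ∧ (∀ z ∈ m.Z, (m.D z).Nonempty) ∧
      ∃ p, Clustering M k (mergeRadius ε k m.R Z') P m.Z m.D p
  | .move Z' z z' => Restructuring k ε P m Z' ∧ (∀ w ∈ m.Z, w ≠ z → (m.D w).Nonempty) ∧
      z ∈ m.Z ∧ z ∉ Z' ∧ z' ∈ Z' ∧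
      ∃ p, Clustering M k (mergeRadius ε k m.R Z') P (m.Z.erase z)
        (Function.update m.D z' (m.D z' ∪ m.D z)) p

/-- The invariant of an execution in which exactly the points of `P` have been placed. The last
field bounds the number of centers also while a restructuring is going on: it remembers an
estimate `R₀`, possibly from before the restructuring, such that all centers but one are near the
first point in terms of `R₀` and have the spacing that belongs to `R₀`. -/
structure Invariant (M : Matroid α) (κ : MatroidKind α) (k : ℕ) (ε : ℝ) (S P : Finset α)
    (m : Memory α) : Prop where
  subset : P ⊆ S
  delegates : DelegateInvariant M κ k P m.Z m.D
  first_mem : m.first ∈ P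
  centers_nonempty : m.Z.Nonempty
  pos : 0 < m.R
  exists_dist_eq : ∃ y ∈ P, dist m.first y = m.R
  ctrl : ControlInvariant M k ε S P m
  packed : ∃ R₀, 0 < R₀ ∧ ∃ y, IsSeparated (spacing ε k R₀) m.Z ∧
    ∀ v ∈ m.Z, v ≠ y → dist v m.first ≤ 2 * R₀

theorem spacing_nonneg (hε : 0 < ε) {R : ℝ} (hR : 0 ≤ R) : 0 ≤ spacing ε k R := by
  unfold spacing; positivity

theorem spacing_mono (hε : 0 < ε) {R R' : ℝ} (h : 2 * R ≤ R') :
    2 * spacing ε k R ≤ spacing ε k R' := by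
  rw [← two_mul_spacing]
  unfold spacing
  have : 2 * ε * R ≤ ε * R' := by nlinarith
  gcongr

theorem le_mergeRadius {α : Type*} [DecidableEq α] {k : ℕ} {ε : ℝ} (hε : 0 < ε) {R : ℝ}
    (hR : 0 ≤ R) (Z' : Finset α) (z : α) : spacing ε k R ≤ mergeRadius ε k R Z' z := by
  have := spacing_nonneg (k := k) hε hR
  unfold mergeRadius
  split_ifs <;> linarith

/-- A maximal separated subset comes close to every point. -/
theorem IsMaximalSeparated.near {t : ℝ} {W W' : Finset α} (h : IsMaximalSeparated t W W')
    (ht : 0 ≤ t) {z : α} (hz : z ∈ W) : ∃ z' ∈ W', dist z z' ≤ t := by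
  by_contra! hfar
  have hz' : z ∉ W' := fun h => absurd (hfar z h) (by simpa using ht)
  refine hz' (h.2 (y := insert z W') ⟨Finset.insert_subset hz h.1.1, ?_⟩
    (Finset.subset_insert _ _) (Finset.mem_insert_self _ _))
  intro u hu v hv huv
  rcases Finset.mem_insert.1 hu with hu' | hu' <;> rcases Finset.mem_insert.1 hv with hv' | hv'
  · exact absurd (hu'.trans hv'.symm) huv
  · rw [hu']; exact hfar v hv'
  · rw [hv', dist_comm]; exact hfar u hu'
  · exact h.1.2 u hu' v hv' huv

theorem Invariant.init {x₁ x₂ : α} (hin : IsInput M κ S k) (hε : 0 < ε) (h₁ : x₁ ∈ S)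
    (h₂ : x₂ ∈ S) (hne : x₁ ≠ x₂) (hε1 : ε < 1) :
    Invariant M κ k ε S {x₁, x₂} (Memory.init x₁ x₂) := by
  have hR : 0 < dist x₁ x₂ := dist_pos.2 hne
  have hk : (1 : ℝ) ≤ k := by exact_mod_cast hin.pos
  have hD : ∀ z ∈ ({x₁, x₂} : Finset α), (Memory.init x₁ x₂).D z = {z} := fun z hz => by
    simp only [Finset.mem_insert, Finset.mem_singleton] at hz
    exact if_pos hz
  have hZS : ({x₁, x₂} : Finset α) ⊆ S :=
    Finset.insert_subset h₁ (Finset.singleton_subset_iff.2 h₂)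
  have ht : spacing ε k (dist x₁ x₂) < dist x₁ x₂ := by
    unfold spacing
    rw [div_lt_iff₀ (by linarith)]
    nlinarith
  have hsep : IsSeparated (spacing ε k (dist x₁ x₂)) ({x₁, x₂} : Finset α) := by
    intro u hu v hv huv
    simp only [Finset.mem_insert, Finset.mem_singleton] at hu hv
    rcases hu with rfl | rfl <;> rcases hv with rfl | rfl
    · exact absurd rfl huv
    · exact ht
    · rwa [dist_comm v u] at ht ⊢
    · exact absurd rfl huv
  have hball : ∀ y ∈ ({x₁, x₂} : Finset α), dist y x₁ ≤ 2 * dist x₁ x₂ := by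
    intro y hy
    simp only [Finset.mem_insert, Finset.mem_singleton] at hy
    rcases hy with rfl | rfl
    · rw [dist_self]; positivity
    · rw [dist_comm]; linarith
  refine ⟨hZS, ⟨subset_rfl, fun z hz => ?_, fun z hz w hw hzw => ?_, fun z hz => ?_⟩,
    Finset.mem_insert_self _ _, Finset.insert_nonempty _ _, hR, ⟨x₂, by simp, rfl⟩,
    ⟨⟨fun z hz => ?_, ⟨id, fun x hx => hx, fun x _ => ?_, fun z hz => ?_⟩, hsep⟩, hball⟩,
    dist x₁ x₂, hR, x₁, hsep, fun v hv _ => hball v hv⟩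
  · rw [hD z hz]; exact Finset.singleton_subset_iff.2 hz
  · rw [hD z hz, hD w hw]; exact Finset.disjoint_singleton.2 hzw
  · rw [hD z hz]; exact .singleton hin (hZS hz)
  · rw [hD z hz]; exact Finset.singleton_nonempty _
  · have := spacing_nonneg (k := k) hε hR.le
    simp only [id, dist_self]
    exact mul_nonneg zero_le_two this
  · rw [hD z hz]
    have : (({x₁, x₂} : Finset α).filter fun x => id x = z) = {z} := by
      ext y
      simp only [Finset.mem_filter, Finset.mem_singleton, id]
      exact ⟨fun h => h.2, fun h => ⟨h ▸ hz, h⟩⟩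
    rw [this]
    exact .refl _ _ _

/-- The points that have been read: those that have been placed, and the one to be placed. -/
def seen (P : Finset α) : Control α → Finset α
  | .place x => insert x P
  | _ => P

theorem Invariant.read (h : Invariant M κ k ε S P m) {x : α} (hc : m.ctrl = .ready)
    (hxS : x ∈ S) (hxP : x ∉ P) : Invariant M κ k ε S P { m with ctrl := .place x } := by
  have hctrl := h.ctrl
  rw [ControlInvariant, hc] at hctrl
  exact ⟨h.subset, h.delegates, h.first_mem, h.centers_nonempty, h.pos, h.exists_dist_eq,
    ⟨⟨hctrl.1.1, hctrl.1.2, hctrl.1.3⟩, hctrl.2, hxS, hxP⟩, h.packed⟩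

theorem Invariant.newCenter (hin : IsInput M κ S k) (hε : 0 < ε) (h : Invariant M κ k ε S P m)
    {x z : α} (hc : m.ctrl = .place x) (hz : IsClosest m.Z x z)
    (hd : 2 * spacing ε k m.R < dist x z) :
    Invariant M κ k ε S (insert x P)
      { m with Z := insert x m.Z, D := Function.update m.D x {x}, ctrl := .check x } := by
  have hctrl := h.ctrl
  rw [ControlInvariant, hc] at hctrl
  obtain ⟨hset, hball, hxS, hxP⟩ := hctrl
  have ht := spacing_nonneg (k := k) hε h.pos.le
  have hxZ : x ∉ m.Z := fun hx => hxP (h.delegates.centers hx)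
  have hfar : ∀ v ∈ m.Z, spacing ε k m.R < dist x v := fun v hv => by linarith [hz.2 v hv]
  have hsep : IsSeparated (spacing ε k m.R) (insert x m.Z) := by
    intro u hu v hv huv
    rcases Finset.mem_insert.1 hu with hu' | hu' <;> rcases Finset.mem_insert.1 hv with hv' | hv'
    · exact absurd (hu'.trans hv'.symm) huv
    · rw [hu']; exact hfar v hv'
    · rw [hv', dist_comm]; exact hfar u hu'
    · exact hset.separated u hu' v hv' huv
  have hball' : ∀ y ∈ insert x P, y ≠ x → dist y m.first ≤ 2 * m.R := fun y hy hyx =>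
    hball y (Finset.mem_of_mem_insert_of_ne hy hyx)
  have hdel := h.delegates.insertCenter hin hxS hxP
  obtain ⟨y, hy, hyR⟩ := h.exists_dist_eq
  obtain ⟨p, hp⟩ := hset.clustering
  refine ⟨Finset.insert_subset hxS h.subset, hdel, Finset.mem_insert_of_mem h.first_mem,
    Finset.insert_nonempty _ _, h.pos, ⟨y, Finset.mem_insert_of_mem hy, hyR⟩,
    ⟨⟨fun w hw => ?_, ⟨_, hp.insertCenter hxP hxZ (by linarith)⟩, hsep⟩, hball',
      Finset.mem_insert_self _ _⟩, m.R, h.pos, x, hsep,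
    fun v hv hvx => hball' v (hdel.centers hv) hvx⟩
  by_cases hwx : w = x
  · subst hwx
    simp only [Function.update_self]; exact Finset.singleton_nonempty _
  · simp only [Function.update_of_ne hwx]
    exact hset.nonempty w (Finset.mem_of_mem_insert_of_ne hw hwx)

theorem Invariant.delegate (hin : IsInput M κ S k) (h : Invariant M κ k ε S P m)
    {x z : α} {E : Finset α} (hc : m.ctrl = .place x) (hz : IsClosest m.Z x z)
    (hd : dist x z ≤ 2 * spacing ε k m.R) (hE : Handles M κ k (m.D z) x E) :
    Invariant M κ k ε S (insert x P)
      { m with D := Function.update m.D z E, ctrl := .check x } := by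
  have hctrl := h.ctrl
  rw [ControlInvariant, hc] at hctrl
  obtain ⟨hset, hball, hxS, hxP⟩ := hctrl
  have hEd := h.delegates.isDelegateSet z hz.1
  obtain ⟨y, hy, hyR⟩ := h.exists_dist_eq
  obtain ⟨p, hp⟩ := hset.clustering
  refine ⟨Finset.insert_subset hxS h.subset,
    h.delegates.handle hin hxS hz.1 (fun w hw _ hxw => hxP (h.delegates.subset w hw hxw)) hE,
    Finset.mem_insert_of_mem h.first_mem, h.centers_nonempty, h.pos,
    ⟨y, Finset.mem_insert_of_mem hy, hyR⟩,
    ⟨⟨fun w hw => ?_, ⟨_, hp.insertPoint hxP hz.1 hd (hE.dominates hin hxS hEd)⟩,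
      hset.separated⟩, fun y hy hyx => hball y (Finset.mem_of_mem_insert_of_ne hy hyx),
      Finset.mem_insert_self _ _⟩, h.packed⟩
  by_cases hwz : w = z
  · subst hwz
    simp only [Function.update_self]
    exact hE.nonempty hin hxS hEd (hset.nonempty w hw)
  · simp only [Function.update_of_ne hwz]
    exact hset.nonempty w hw

theorem Invariant.keepEstimate (h : Invariant M κ k ε S P m) {x : α} (hc : m.ctrl = .check x)
    (hd : dist x m.first ≤ 2 * m.R) : Invariant M κ k ε S P { m with ctrl := .ready } := by
  have hctrl := h.ctrl
  rw [ControlInvariant, hc] at hctrl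
  obtain ⟨hset, hball, -⟩ := hctrl
  refine ⟨h.subset, h.delegates, h.first_mem, h.centers_nonempty, h.pos, h.exists_dist_eq,
    ⟨⟨hset.1, hset.2, hset.3⟩, fun y hy => ?_⟩, h.packed⟩
  by_cases hyx : y = x
  · subst hyx; exact hd
  · exact hball y hy hyx

theorem Invariant.newEstimate (hε : 0 < ε) (h : Invariant M κ k ε S P m) {x : α} {Z' : Finset α}
    (hc : m.ctrl = .check x) (hd : 2 * m.R < dist x m.first)
    (hZ' : IsMaximalSeparated (spacing ε k (dist x m.first)) m.Z Z') :
    Invariant M κ k ε S P { m with R := dist x m.first, ctrl := .merge Z' } := by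
  have hctrl := h.ctrl
  rw [ControlInvariant, hc] at hctrl
  obtain ⟨hset, hball, hxP⟩ := hctrl
  have hpos := h.pos
  have hR' : 0 < dist x m.first := by linarith
  have ht := spacing_nonneg (k := k) hε hR'.le
  obtain ⟨p, hp⟩ := hset.clustering
  obtain ⟨c, hcZ⟩ := h.centers_nonempty
  obtain ⟨z', hz', -⟩ := hZ'.near ht hcZ
  refine ⟨h.subset, h.delegates, h.first_mem, h.centers_nonempty, hR', ⟨x, hxP, dist_comm _ _⟩,
    ⟨⟨hZ'.1.1, ⟨z', hz'⟩, hZ'.1.2, fun z hz => hZ'.near ht hz, fun y hy => ?_⟩, hset.nonempty,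
      p, hp.mono fun z _ => ?_⟩, h.packed⟩
  · by_cases hyx : y = x
    · subst hyx; exact le_mul_of_one_le_left hR'.le one_le_two
    · exact (hball y hy hyx).trans (by simp only; linarith)
  · exact (spacing_mono hε hd.le).trans (le_mergeRadius hε hR'.le _ _)

theorem Invariant.pickCenter (h : Invariant M κ k ε S P m) {Z' : Finset α}
    {z z' : α} (hc : m.ctrl = .merge Z') (hz : z ∈ m.Z \ Z') (hz' : IsClosest Z' z z') :
    Invariant M κ k ε S P { m with ctrl := .move Z' z z' } := by
  have hctrl := h.ctrl
  rw [ControlInvariant, hc] at hctrl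
  obtain ⟨hres, hne, p, hp⟩ := hctrl
  rw [Finset.mem_sdiff] at hz
  refine ⟨h.subset, h.delegates, h.first_mem, h.centers_nonempty, h.pos, h.exists_dist_eq,
    ⟨⟨hres.1, hres.2, hres.3, hres.4, hres.5⟩, fun w hw _ => hne w hw, hz.1, hz.2, hz'.1, _,
      hp.absorb hz.1 (hres.subset hz'.1) (fun h => hz.2 (h ▸ hz'.1)) ?_⟩, h.packed⟩
  obtain ⟨w, hw, hzw⟩ := hres.near z hz.1
  simp only [mergeRadius, if_pos hz'.1, if_neg hz.2]
  linarith [hz'.2 w hw]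

theorem Invariant.moveDelegate (hin : IsInput M κ S k) (h : Invariant M κ k ε S P m)
    {Z' E : Finset α} {z z' x : α} (hc : m.ctrl = .move Z' z z') (hx : x ∈ m.D z)
    (hE : Handles M κ k (m.D z') x E) :
    Invariant M κ k ε S P
      { m with D := Function.update (Function.update m.D z ((m.D z).erase x)) z' E } := by
  have hctrl := h.ctrl
  rw [ControlInvariant, hc] at hctrl
  obtain ⟨hres, hne, hzZ, hzZ', hz', p, hp⟩ := hctrl
  have hzz' : z' ≠ z := fun h => hzZ' (h ▸ hz')
  have hz'Z := hres.subset hz'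
  have hxP : x ∈ P := h.delegates.subset z hzZ hx
  have hEd := h.delegates.isDelegateSet z' hz'Z
  have hdom := hE.dominates hin (h.subset hxP) hEd
  have hdel : DelegateInvariant M κ k P m.Z
      (Function.update (Function.update m.D z ((m.D z).erase x)) z' E) := by
    have := (h.delegates.erase z x).handle hin (h.subset hxP) hz'Z (fun w hw hwz' => ?_)
      (E := E) (by rwa [Function.update_of_ne hzz'])
    · rwa [Finset.insert_eq_of_mem hxP] at this
    · by_cases hwz : w = z
      · subst hwz; rw [Function.update_self]; exact Finset.notMem_erase _ _
      · rw [Function.update_of_ne hwz]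
        exact Finset.disjoint_left.1 (h.delegates.disjoint z hzZ w hw (Ne.symm hwz)) hx
  refine ⟨h.subset, hdel, h.first_mem, h.centers_nonempty, h.pos, h.exists_dist_eq, ?_, h.packed⟩
  simp only [ControlInvariant, hc]
  refine ⟨⟨hres.1, hres.2, hres.3, hres.4, hres.5⟩, fun w hw hwz => ?_, hzZ, hzZ', hz', p,
    hp.trans fun w hw => ?_⟩
  · by_cases hwz' : w = z'
    · subst hwz'
      rw [Function.update_self]
      exact hE.nonempty hin (h.subset hxP) hEd (hne w hw hwz)
    · rw [Function.update_of_ne hwz', Function.update_of_ne hwz]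
      exact hne w hw hwz
  · by_cases hwz' : w = z'
    · subst hwz'
      rw [Function.update_self, Function.update_self, Function.update_self,
        Function.update_of_ne hzz'.symm, Function.update_self]
      have hsplit : m.D w ∪ m.D z = insert x (m.D w) ∪ (m.D z).erase x := by
        ext y; by_cases hyx : y = x
        · subst hyx; simp [hx]
        · simp [hyx]
      rw [hsplit]
      refine hdom.union (.refl _ _ _) (Finset.disjoint_insert_left.2
        ⟨Finset.notMem_erase _ _, ?_⟩)
      exact (h.delegates.disjoint w hz'Z z hzZ hzz').mono_right (Finset.erase_subset _ _)
    · rw [Function.update_of_ne hwz', Function.update_of_ne hwz', Function.update_of_ne hwz',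
        Function.update_of_ne (Finset.ne_of_mem_erase hw)]
      exact .refl _ _ _

theorem Invariant.dropCenter (h : Invariant M κ k ε S P m) {Z' : Finset α} {z z' : α}
    (hc : m.ctrl = .move Z' z z') (hz : m.D z = ∅) :
    Invariant M κ k ε S P { m with Z := m.Z.erase z, ctrl := .merge Z' } := by
  have hctrl := h.ctrl
  rw [ControlInvariant, hc] at hctrl
  obtain ⟨hres, hne, hzZ, hzZ', hz', p, hp⟩ := hctrl
  have hsub := Finset.erase_subset z m.Z
  have hzz' : z' ≠ z := fun h => hzZ' (h ▸ hz')
  rw [hz, Finset.union_empty, Function.update_eq_self] at hp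
  obtain ⟨R₀, hR₀, y, hsep, hball⟩ := h.packed
  exact ⟨h.subset, h.delegates.mono hsub, h.first_mem,
    ⟨z', Finset.mem_erase.2 ⟨hzz', hres.subset hz'⟩⟩, h.pos, h.exists_dist_eq,
    ⟨⟨fun w hw => Finset.mem_erase.2 ⟨fun h => hzZ' (h ▸ hw), hres.subset hw⟩, hres.2, hres.3,
      fun w hw => hres.near w (hsub hw), hres.5⟩,
      fun w hw => hne w (hsub hw) (Finset.ne_of_mem_erase hw), p, hp⟩,
    R₀, hR₀, y, fun u hu v hv => hsep u (hsub hu) v (hsub hv), fun v hv => hball v (hsub hv)⟩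

theorem Invariant.mergeDone (h : Invariant M κ k ε S P m) {Z' : Finset α}
    (hc : m.ctrl = .merge Z') (hZ : m.Z \ Z' = ∅) :
    Invariant M κ k ε S P { m with Z := Z', ctrl := .ready } := by
  have hctrl := h.ctrl
  rw [ControlInvariant, hc] at hctrl
  obtain ⟨hres, hne, p, hp⟩ := hctrl
  obtain rfl : m.Z = Z' := (Finset.sdiff_eq_empty_iff_subset.1 hZ).antisymm hres.subset
  exact ⟨h.subset, h.delegates, h.first_mem, h.centers_nonempty, h.pos, h.exists_dist_eq,
    ⟨⟨hne, ⟨p, hp.mono fun z hz => by simp only [mergeRadius, if_pos hz, le_refl]⟩, hres.3⟩,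
      hres.5⟩, h.packed⟩

/-- A step on the working memory preserves the invariant and the set of points read. -/
theorem Invariant.step (hin : IsInput M κ S k) (hε : 0 < ε) (h : Invariant M κ k ε S P m)
    (hs : Step M κ k ε 32 m none m') :
    ∃ P', Invariant M κ k ε S P' m' ∧ seen P' m'.ctrl = seen P m.ctrl := by
  cases hs with
  | newCenter x z hc hz hd =>
    rw [two_mul_spacing] at hd
    exact ⟨_, h.newCenter hin hε hc hz hd, by simp [seen, hc]⟩
  | delegate x z E hc hz hd hE =>
    rw [two_mul_spacing] at hd
    exact ⟨_, h.delegate hin hc hz hd hE, by simp [seen, hc]⟩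
  | keepEstimate x hc hd => exact ⟨_, h.keepEstimate hc hd, by simp [seen, hc]⟩
  | newEstimate x Z' hc hd hZ' => exact ⟨_, h.newEstimate hε hc hd hZ', by simp [seen, hc]⟩
  | pickCenter Z' z z' hc hz hz' => exact ⟨_, h.pickCenter hc hz hz', by simp [seen, hc]⟩
  | moveDelegate Z' z z' x E hc hx hE =>
    exact ⟨_, h.moveDelegate hin hc hx hE, by simp [seen, hc]⟩
  | dropCenter Z' z z' hc hz => exact ⟨_, h.dropCenter hc hz, by simp [seen, hc]⟩
  | mergeDone Z' hc hZ => exact ⟨_, h.mergeDone hc hZ, by simp [seen, hc]⟩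

theorem Exec.invariant (hin : IsInput M κ S k) (hε : 0 < ε) (hε1 : ε < 1) {ys : List α}
    (h : Exec M κ k ε 32 ys m) (hnd : ys.Nodup) (hS : ∀ y ∈ ys, y ∈ S) :
    ∃ P, Invariant M κ k ε S P m ∧ seen P m.ctrl = ys.toFinset := by
  induction h with
  | init x₁ x₂ =>
    refine ⟨_, .init hin hε (hS _ (by simp)) (hS _ (by simp)) (by simpa using hnd) hε1, ?_⟩
    simp [seen, Memory.init]
  | internal ys m m' _ hs ih =>
    obtain ⟨P, hP, hseen⟩ := ih hnd hS
    obtain ⟨P', hP', h'⟩ := hP.step hin hε hs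
    exact ⟨P', hP', h'.trans hseen⟩
  | next ys x m m' _ hs ih =>
    rw [List.nodup_append] at hnd
    obtain ⟨P, hP, hseen⟩ := ih hnd.1 fun y hy => hS y (List.mem_append_left _ hy)
    cases hs with
    | read _ hc =>
      simp only [hc, seen] at hseen
      refine ⟨P, hP.read hc (hS x (by simp)) ?_, ?_⟩
      · rw [hseen, List.mem_toFinset]
        exact fun hx => hnd.2.2 x hx x (by simp) rfl
      · ext y; simp [seen, hseen]

end Executions

section Bounds

variable {α : Type*} [MetricSpace α] [DecidableEq α] {M : Matroid α} {κ : MatroidKind α} {k : ℕ}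
  {S P Z : Finset α} {ε c : ℝ} {m m' : Memory α} {γ : ℕ}

/-! ### Termination -/

theorem acc_ready (h : m.ctrl = .ready) :
    Acc (fun m₂ m₁ => Step M κ k ε c m₁ none m₂) m := by
  refine ⟨_, fun m' hs => ?_⟩
  cases hs <;> simp_all

/-- A bound for the number of steps that are needed to eliminate the centers outside `Z'`. -/
def mergeWork (m : Memory α) (Z' : Finset α) : ℕ :=
  ∑ z ∈ m.Z \ Z', ((m.D z).card + 2)

/-- The work `mergeWork m Z'` decreases with every delegate that is moved and every center that is
dropped, and choosing the next center to eliminate is paid for by the strict inequality. -/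
theorem acc_restructuring (n : ℕ) : ∀ m : Memory α,
    (∃ Z', m.ctrl = .merge Z' ∧ mergeWork m Z' < n) ∨
      (∃ Z' z z', m.ctrl = .move Z' z z' ∧ z ∈ m.Z ∧ z ∉ Z' ∧ z' ∈ Z' ∧ mergeWork m Z' ≤ n) →
    Acc (fun m₂ m₁ => Step M κ k ε c m₁ none m₂) m := by
  induction n with
  | zero =>
    rintro m (⟨Z', -, h⟩ | ⟨Z', z, z', -, hz, hzZ', -, h⟩)
    · exact absurd h (Nat.not_lt_zero _)
    · have : (m.D z).card + 2 ≤ mergeWork m Z' :=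
        Finset.single_le_sum (f := fun z => (m.D z).card + 2) (fun _ _ => Nat.zero_le _)
          (Finset.mem_sdiff.2 ⟨hz, hzZ'⟩)
      omega
  | succ n ih =>
    rintro m (⟨Z', hc, h⟩ | ⟨Z', z, z', hc, hz, hzZ', hz', h⟩)
    · refine ⟨_, fun m' hs => ?_⟩
      cases hs with
      | pickCenter Z₁ z z' hc' hz hz' =>
        obtain rfl : Z' = Z₁ := by rw [hc] at hc'; simpa using hc'
        rw [Finset.mem_sdiff] at hz
        exact ih _ (.inr ⟨_, z, z', rfl, hz.1, hz.2, hz'.1, Nat.lt_succ_iff.1 h⟩)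
      | mergeDone Z₁ hc' hZ => exact acc_ready rfl
      | _ => simp_all
    · refine ⟨_, fun m' hs => ?_⟩
      have hmem : z ∈ m.Z \ Z' := Finset.mem_sdiff.2 ⟨hz, hzZ'⟩
      have hzz' : z ≠ z' := fun h => hzZ' (h ▸ hz')
      have hsum : ∀ f : α → ℕ, ∑ w ∈ m.Z \ Z', f w = f z + ∑ w ∈ (m.Z \ Z').erase z, f w :=
        fun f => (Finset.add_sum_erase _ _ hmem).symm
      cases hs with
      | moveDelegate Z₁ z₁ z₁' x E hc' hx hE =>
        obtain ⟨rfl, rfl, rfl⟩ : Z' = Z₁ ∧ z = z₁ ∧ z' = z₁' := by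
          rw [hc] at hc'; simpa using hc'
        refine ih _ (.inr ⟨_, z, z', hc, hz, hzZ', hz', ?_⟩)
        have hpos := Finset.card_pos.2 ⟨x, hx⟩
        have hrest : ∑ w ∈ (m.Z \ Z').erase z,
            ((Function.update (Function.update m.D z ((m.D z).erase x)) z' E w).card + 2) =
            ∑ w ∈ (m.Z \ Z').erase z, ((m.D w).card + 2) := by
          refine Finset.sum_congr rfl fun w hw => ?_
          obtain ⟨hwz, hw⟩ := Finset.mem_erase.1 hw
          have hwz' : w ≠ z' := fun h => (Finset.mem_sdiff.1 hw).2 (h ▸ hz')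
          rw [Function.update_of_ne hwz', Function.update_of_ne hwz]
        unfold mergeWork at h ⊢
        rw [hsum] at h ⊢
        simp only
        rw [hrest, Function.update_of_ne hzz', Function.update_self, Finset.card_erase_of_mem hx]
        omega
      | dropCenter Z₁ z₁ z₁' hc' hD =>
        obtain ⟨rfl, rfl, rfl⟩ : Z' = Z₁ ∧ z = z₁ ∧ z' = z₁' := by
          rw [hc] at hc'; simpa using hc'
        refine ih _ (.inl ⟨_, rfl, ?_⟩)
        unfold mergeWork at h ⊢
        rw [hsum] at h
        simp only [Finset.erase_sdiff_comm]
        omega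
      | _ => simp_all

theorem acc_check {x : α} (h : m.ctrl = .check x) :
    Acc (fun m₂ m₁ => Step M κ k ε c m₁ none m₂) m := by
  refine ⟨_, fun m' hs => ?_⟩
  cases hs with
  | keepEstimate => exact acc_ready rfl
  | newEstimate y Z' => exact acc_restructuring _ _ (.inl ⟨Z', rfl, Nat.lt_succ_self _⟩)
  | _ => simp_all

theorem acc_place {x : α} (h : m.ctrl = .place x) :
    Acc (fun m₂ m₁ => Step M κ k ε c m₁ none m₂) m := by
  refine ⟨_, fun m' hs => ?_⟩
  cases hs with
  | newCenter y => exact acc_check (x := y) rfl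
  | delegate y => exact acc_check (x := y) rfl
  | _ => simp_all

theorem Invariant.acc (h : Invariant M κ k ε S P m) :
    Acc (fun m₂ m₁ => Step M κ k ε c m₁ none m₂) m := by
  have hctrl := h.ctrl
  rcases hc : m.ctrl with _ | x | x | Z' | ⟨Z', z, z'⟩
  · exact acc_ready hc
  · exact acc_place hc
  · exact acc_check hc
  · exact acc_restructuring _ _ (.inl ⟨Z', hc, Nat.lt_succ_self _⟩)
  · rw [ControlInvariant, hc] at hctrl
    obtain ⟨-, -, h1, h2, h3, -⟩ := hctrl
    exact acc_restructuring _ _ (.inr ⟨Z', z, z', hc, h1, h2, h3, le_rfl⟩)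

theorem exists_isClosest {α : Type*} [MetricSpace α] {W : Finset α} (hW : W.Nonempty) (x : α) :
    ∃ z, IsClosest W x z := by
  obtain ⟨z, hz, h⟩ := W.exists_min_image (dist x) hW
  exact ⟨z, hz, h⟩

theorem exists_isMaximalSeparated {α : Type*} [MetricSpace α] (t : ℝ) (W : Finset α) :
    ∃ W', IsMaximalSeparated t W W' := by
  have hfin : {V : Finset α | V ⊆ W ∧ ∀ u ∈ V, ∀ v ∈ V, u ≠ v → t < dist u v}.Finite :=
    W.powerset.finite_toSet.subset fun _ hV => Finset.mem_coe.2 (Finset.mem_powerset.2 hV.1)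
  exact hfin.exists_maximal ⟨∅, by simp⟩

theorem Invariant.exists_step (h : Invariant M κ k ε S P m) :
    m.ctrl = .ready ∨ ∃ m', Step M κ k ε c m none m' := by
  have hctrl := h.ctrl
  rcases hc : m.ctrl with _ | x | x | Z' | ⟨Z', z, z'⟩
  · exact .inl rfl
  · obtain ⟨z, hz⟩ := exists_isClosest h.centers_nonempty x
    rcases lt_or_ge (2 * ε * m.R / (c * k)) (dist x z) with hd | hd
    · exact .inr ⟨_, .newCenter m x z hc hz hd⟩
    · obtain ⟨E, hE⟩ := Handles.exists M κ k (m.D z) x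
      exact .inr ⟨_, .delegate m x z E hc hz hd hE⟩
  · rcases lt_or_ge (2 * m.R) (dist x m.first) with hd | hd
    · obtain ⟨Z', hZ'⟩ := exists_isMaximalSeparated (ε * dist x m.first / (c * k)) m.Z
      exact .inr ⟨_, .newEstimate m x Z' hc hd hZ'⟩
    · exact .inr ⟨_, .keepEstimate m x hc hd⟩
  · rw [ControlInvariant, hc] at hctrl
    rcases (m.Z \ Z').eq_empty_or_nonempty with hZ | ⟨z, hz⟩
    · exact .inr ⟨_, .mergeDone m Z' hc hZ⟩
    · obtain ⟨z', hz'⟩ := exists_isClosest hctrl.1.nonempty z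
      exact .inr ⟨_, .pickCenter m Z' z z' hc hz hz'⟩
  · rcases (m.D z).eq_empty_or_nonempty with hz | ⟨x, hx⟩
    · exact .inr ⟨_, .dropCenter m Z' z z' hc hz⟩
    · obtain ⟨E, hE⟩ := Handles.exists M κ k (m.D z') x
      exact .inr ⟨_, .moveDelegate m Z' z z' x E hc hx hE⟩

theorem Exec.exists_ready (hin : IsInput M κ S k) (hε : 0 < ε) {ys : List α}
    (h : Exec M κ k ε 32 ys m) (hinv : Invariant M κ k ε S P m) :
    ∃ m', Exec M κ k ε 32 ys m' ∧ m'.ctrl = .ready := by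
  have hacc : Acc (fun m₂ m₁ => Step M κ k ε 32 m₁ none m₂) m := hinv.acc
  induction hacc generalizing P with
  | intro m _ ih =>
    rcases hinv.exists_step (c := 32) with hc | ⟨m', hs⟩
    · exact ⟨m, h, hc⟩
    · obtain ⟨P', hP', -⟩ := hinv.step hin hε hs
      exact ih m' hs (.internal _ _ _ h hs) hP'

theorem exists_exec_ready (hin : IsInput M κ S k) (hε : 0 < ε) (hε1 : ε < 1) {x₁ x₂ : α}
    (l : List α) (hnd : (x₁ :: x₂ :: l).Nodup) (hS : ∀ y ∈ x₁ :: x₂ :: l, y ∈ S) :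
    ∃ m, Exec M κ k ε 32 (x₁ :: x₂ :: l) m ∧ m.ctrl = .ready := by
  induction l using List.reverseRecOn with
  | nil => exact ⟨_, .init x₁ x₂, rfl⟩
  | append_singleton l x ih =>
    have happ : x₁ :: x₂ :: (l ++ [x]) = (x₁ :: x₂ :: l) ++ [x] := rfl
    rw [happ] at hnd hS ⊢
    obtain ⟨m, hm, hc⟩ := ih (List.nodup_append.1 hnd).1
      fun y hy => hS y (List.mem_append_left _ hy)
    have hexec := Exec.next _ x _ _ hm (.read m x hc)
    obtain ⟨P, hP, -⟩ := hexec.invariant hin hε hε1 hnd hS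
    exact hexec.exists_ready hin hε hP

/-! ### The working memory -/

theorem card_delegates (h : Invariant M κ k ε S P m) :
    m.delegates.card = ∑ z ∈ m.Z, (m.D z).card :=
  Finset.card_biUnion fun z hz w hw hzw => h.delegates.disjoint z hz w hw hzw

/-- At most one delegate set, that of a center which is being eliminated, is empty. -/
theorem Invariant.exists_nonempty (h : Invariant M κ k ε S P m) :
    ∃ z₀, (∀ z ∈ m.Z, z ≠ z₀ → (m.D z).Nonempty) ∧ ∃ z ∈ m.Z, (m.D z).Nonempty := by
  obtain ⟨c, hcZ⟩ := h.centers_nonempty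
  have hctrl := h.ctrl
  rcases hc : m.ctrl with _ | x | x | Z' | ⟨Z', z, z'⟩ <;> rw [ControlInvariant, hc] at hctrl
  · exact ⟨c, fun z hz _ => hctrl.1.nonempty z hz, c, hcZ, hctrl.1.nonempty c hcZ⟩
  · exact ⟨c, fun z hz _ => hctrl.1.nonempty z hz, c, hcZ, hctrl.1.nonempty c hcZ⟩
  · exact ⟨c, fun z hz _ => hctrl.1.nonempty z hz, c, hcZ, hctrl.1.nonempty c hcZ⟩
  · exact ⟨c, fun z hz _ => hctrl.2.1 z hz, c, hcZ, hctrl.2.1 c hcZ⟩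
  · obtain ⟨hres, hne, -, hzZ', hz', -⟩ := hctrl
    exact ⟨z, hne, z', hres.subset hz', hne z' (hres.subset hz') fun h => hzZ' (h ▸ hz')⟩

theorem Invariant.one_le_card_delegates (h : Invariant M κ k ε S P m) :
    1 ≤ m.delegates.card := by
  obtain ⟨-, -, z, hz, x, hx⟩ := h.exists_nonempty
  exact Finset.card_pos.2 ⟨x, Finset.mem_biUnion.2 ⟨z, hz, hx⟩⟩

theorem Invariant.card_centers_le (h : Invariant M κ k ε S P m) :
    m.Z.card ≤ m.delegates.card + 1 := by
  obtain ⟨z₀, hne, -⟩ := h.exists_nonempty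
  have h1 : (m.Z.erase z₀).card ≤ ∑ z ∈ m.Z.erase z₀, (m.D z).card := by
    rw [Finset.card_eq_sum_ones]
    exact Finset.sum_le_sum fun z hz =>
      Finset.card_pos.2 (hne z (Finset.mem_of_mem_erase hz) (Finset.ne_of_mem_erase hz))
  have h2 : ∑ z ∈ m.Z.erase z₀, (m.D z).card ≤ ∑ z ∈ m.Z, (m.D z).card :=
    Finset.sum_le_sum_of_subset (Finset.erase_subset _ _)
  have h3 := Finset.pred_card_le_card_erase (s := m.Z) (a := z₀)
  rw [card_delegates h]
  omega

theorem numCategories_le {α : Type*} [DecidableEq α] {M : Matroid α} {κ : MatroidKind α}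
    {S : Finset α} (hin : IsInput M κ S k) (hγ : κ.BoundedOverlap S γ) {x : α} (hx : x ∈ S) :
    κ.numCategories x ≤ γ + 1 := by
  cases κ with
  | partition n A b =>
    have hM : IsPartitionMatroid M S A b := hin.kind
    have : (Finset.univ.filter fun i => x ∈ A i).card ≤ 1 := by
      refine Finset.card_le_one.2 fun i hi j hj => ?_
      rw [Finset.mem_filter] at hi hj
      by_contra hij
      exact Finset.disjoint_left.1 (hM.disjoint i j hij) hi.2 hj.2
    exact this.trans (by omega)
  | transversal n A => exact (hγ x hx).trans (Nat.le_succ γ)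
  | other => exact Nat.zero_le _

theorem Invariant.words_le (hin : IsInput M κ S k) (hγ : κ.BoundedOverlap S γ)
    (h : Invariant M κ k ε S P m) : m.words κ ≤ 9 * (γ + 2) * m.delegates.card := by
  have hw : ∀ x ∈ S, 1 + κ.numCategories x ≤ γ + 2 := fun x hx => by
    have := numCategories_le hin hγ hx
    omega
  have hsum : ∀ V ⊆ S, ∑ x ∈ V, (1 + κ.numCategories x) ≤ V.card * (γ + 2) := fun V hV => by
    rw [← smul_eq_mul]; exact Finset.sum_le_card_nsmul _ _ _ fun x hx => hw x (hV hx)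
  have hZS : m.Z ⊆ S := h.delegates.centers.trans h.subset
  have h1 := h.one_le_card_delegates
  have h2 := h.card_centers_le
  have hD : ∑ z ∈ m.Z, ∑ x ∈ m.D z, (1 + κ.numCategories x) ≤
      m.delegates.card * (γ + 2) := by
    rw [card_delegates h, Finset.sum_mul]
    exact Finset.sum_le_sum fun z hz => hsum _ ((h.delegates.subset z hz).trans h.subset)
  have hctrl : m.ctrl.words (fun x => 1 + κ.numCategories x) ≤ (m.Z.card + 2) * (γ + 2) := by
    have hctrl := h.ctrl
    have hsub : ∀ Z' ⊆ m.Z, ∑ x ∈ Z', (1 + κ.numCategories x) ≤ m.Z.card * (γ + 2) :=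
      fun Z' hZ' => (hsum Z' (hZ'.trans hZS)).trans
        (Nat.mul_le_mul_right _ (Finset.card_le_card hZ'))
    rw [add_mul]
    rcases hc : m.ctrl with _ | x | x | Z' | ⟨Z', z, z'⟩ <;> rw [ControlInvariant, hc] at hctrl
      <;> simp only [Control.words]
    · exact Nat.zero_le _
    · have := hw x hctrl.2.2.1
      omega
    · have := hw x (h.subset hctrl.2.2)
      omega
    · have := hsub Z' hctrl.1.subset
      omega
    · have := hsub Z' hctrl.1.subset
      have := hw z (hZS hctrl.2.2.1)
      have := hw z' (hZS (hctrl.1.subset hctrl.2.2.2.2.1))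
      omega
  have hfirst := hw _ (h.subset h.first_mem)
  have hZ := hsum _ hZS
  have hword : m.words κ ≤ (γ + 2) + 1 + m.Z.card * (γ + 2) + m.delegates.card * (γ + 2) +
      (m.Z.card + 2) * (γ + 2) := by
    unfold Memory.words
    simp only
    omega
  refine hword.trans ?_
  have h3 : m.Z.card ≤ 2 * m.delegates.card := by omega
  nlinarith [Nat.mul_le_mul_right (γ + 2) h3, Nat.mul_le_mul_right (γ + 2) h1]

/-! ### Doubling dimension and the number of centers -/

/-- The infimum in the definition of the doubling dimension is attained, because the cardinality of
a cover is an integer. -/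
theorem halvesBalls_of_doublingDimension_le {α : Type*} [MetricSpace α] {S : Finset α} {D : ℝ}
    (hS : S.Nonempty) (h : doublingDimension S ≤ D) : 0 ≤ D ∧ HalvesBalls S D := by
  have hnn : ∀ D', HalvesBalls S D' → 0 ≤ D' := by
    intro D' hD'
    obtain ⟨x, hx⟩ := hS
    obtain ⟨Y, -, hYc, hY⟩ := hD' x hx 0 le_rfl
    obtain ⟨c, hc, -⟩ := hY x hx (by simp)
    have h1 : (1 : ℝ) ≤ 2 ^ D' := le_trans (by exact_mod_cast Finset.card_pos.2 ⟨c, hc⟩) hYc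
    by_contra! hneg
    exact absurd (Real.rpow_lt_one_of_one_lt_of_neg one_lt_two hneg) (not_lt.2 h1)
  have hne : {D' | HalvesBalls S D'}.Nonempty := by
    refine ⟨Real.logb 2 S.card, fun x hx r hr => ⟨S, subset_rfl, ?_, fun y hy _ => ⟨y, hy, ?_⟩⟩⟩
    · rw [Real.rpow_logb two_pos (by norm_num) (by exact_mod_cast Finset.card_pos.2 hS)]
    · rw [dist_self]; positivity
  refine ⟨(le_csInf hne hnn).trans h, fun x hx r hr => ?_⟩
  have hpow : (0 : ℝ) < 2 ^ D := Real.rpow_pos_of_pos two_pos D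
  -- exponents slightly above `D` allow no further point
  have hlt : D < Real.logb 2 (⌊(2 : ℝ) ^ D⌋₊ + 1) := by
    rw [Real.lt_logb_iff_rpow_lt one_lt_two (by positivity)]
    exact Nat.lt_floor_add_one _
  obtain ⟨D', hD', hDlt⟩ := exists_lt_of_csInf_lt hne (h.trans_lt hlt)
  obtain ⟨Y, hYS, hYc, hY⟩ := hD' x hx r hr
  refine ⟨Y, hYS, ?_, hY⟩
  rw [Real.lt_logb_iff_rpow_lt one_lt_two (by positivity)] at hDlt
  have : Y.card < ⌊(2 : ℝ) ^ D⌋₊ + 1 := by exact_mod_cast hYc.trans_lt hDlt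
  exact (Nat.cast_le.2 (Nat.lt_succ_iff.1 this)).trans (Nat.floor_le hpow.le)

/-- Iterated halving. -/
theorem HalvesBalls.exists_cover {D : ℝ} (h : HalvesBalls S D) (j : ℕ) : ∀ x ∈ S, ∀ r : ℝ, 0 ≤ r →
    ∃ Y ⊆ S, (Y.card : ℝ) ≤ ((2 : ℝ) ^ D) ^ j ∧
      ∀ y ∈ S, dist y x ≤ r → ∃ c ∈ Y, dist y c ≤ r / 2 ^ j := by
  induction j with
  | zero =>
    intro x hx r _
    exact ⟨{x}, by simpa using hx, by simp, fun y _ hyr => ⟨x, by simp, by simpa using hyr⟩⟩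
  | succ j ih =>
    intro x hx r hr
    obtain ⟨Y, hYS, hYc, hY⟩ := ih x hx r hr
    have hr' : 0 ≤ r / 2 ^ j := by positivity
    have hex : ∀ c : α, ∃ V : Finset α, c ∈ S → V ⊆ S ∧ (V.card : ℝ) ≤ (2 : ℝ) ^ D ∧
        ∀ y ∈ S, dist y c ≤ r / 2 ^ j → ∃ c' ∈ V, dist y c' ≤ r / 2 ^ j / 2 := fun c => by
      by_cases hc : c ∈ S
      · obtain ⟨V, hV⟩ := h c hc _ hr'
        exact ⟨V, fun _ => hV⟩
      · exact ⟨∅, fun h => absurd h hc⟩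
    choose V hV using hex
    refine ⟨Y.biUnion V, ?_, ?_, fun y hy hyr => ?_⟩
    · exact Finset.biUnion_subset.2 fun c hc => (hV c (hYS hc)).1
    · calc ((Y.biUnion V).card : ℝ) ≤ ∑ c ∈ Y, ((V c).card : ℝ) := by
            exact_mod_cast Finset.card_biUnion_le
        _ ≤ Y.card • ((2 : ℝ) ^ D) := Finset.sum_le_card_nsmul _ _ _ fun c hc =>
            (hV c (hYS hc)).2.1
        _ ≤ ((2 : ℝ) ^ D) ^ j * (2 : ℝ) ^ D := by
            rw [nsmul_eq_mul]
            exact mul_le_mul_of_nonneg_right hYc (by positivity)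
        _ = _ := (pow_succ _ _).symm
    · obtain ⟨c, hc, hyc⟩ := hY y hy hyr
      obtain ⟨c', hc', hyc'⟩ := (hV c (hYS hc)).2.2 y hy hyc
      exact ⟨c', Finset.mem_biUnion.2 ⟨c, hc, hc'⟩, by rwa [pow_succ, ← div_div]⟩

/-- The number of separated points in a ball: each of the small balls that cover the ball contains
at most one of them. -/
theorem HalvesBalls.card_le {D t r : ℝ} (h : HalvesBalls S D) {j : ℕ} {V : Finset α} (hVS : V ⊆ S)
    {a : α} (ha : a ∈ S) (hr : 0 ≤ r) (hball : ∀ v ∈ V, dist v a ≤ r) (hsep : IsSeparated t V)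
    (hj : 2 * r ≤ t * 2 ^ j) : (V.card : ℝ) ≤ ((2 : ℝ) ^ D) ^ j := by
  obtain ⟨Y, -, hYc, hY⟩ := h.exists_cover j a ha r hr
  have hex : ∀ v : α, ∃ c, v ∈ V → c ∈ Y ∧ dist v c ≤ r / 2 ^ j := fun v => by
    by_cases hv : v ∈ V
    · obtain ⟨c, hc⟩ := hY v (hVS hv) (hball v hv)
      exact ⟨c, fun _ => hc⟩
    · exact ⟨v, fun h => absurd h hv⟩
  choose f hf using hex
  have hinj : Set.InjOn f ↑V := by
    intro u hu v hv huv
    by_contra hne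
    have h1 := (hf u hu).2
    have h2 := (hf v hv).2
    rw [← huv] at h2
    have h3 : 2 * (r / 2 ^ j) ≤ t := by
      rw [← mul_div_assoc, div_le_iff₀ (by positivity)]; exact hj
    linarith [hsep u hu v hv hne, dist_triangle_right u v (f u)]
  exact le_trans (by exact_mod_cast Finset.card_le_card_of_injOn f (fun v hv => (hf v hv).1) hinj)
    hYc

/-- The number of centers: at every moment, the centers but one are packed into a ball whose radius
is `64 * k / ε` times their spacing. -/
theorem Invariant.card_centers_le_rpow (hin : IsInput M κ S k) (hε : 0 < ε) (hε1 : ε < 1)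
    (h : Invariant M κ k ε S P m) {D : ℝ} (hD0 : 0 ≤ D) (hD : HalvesBalls S D) :
    (m.Z.card : ℝ) ≤ 2 * 256 ^ D * (k / ε) ^ D := by
  obtain ⟨R₀, hR₀, y, hsep, hball⟩ := h.packed
  have hk : (1 : ℝ) ≤ k := by exact_mod_cast hin.pos
  have hkε : 1 ≤ k / ε := by rw [le_div_iff₀ hε]; linarith
  -- halve until the radius `2 * R₀` has come down to half the spacing
  obtain ⟨n, hn, hn'⟩ := exists_nat_pow_near (x := 128 * (k / ε)) (y := 2) (by linarith)
    one_lt_two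
  have hV : ((m.Z.erase y).card : ℝ) ≤ ((2 : ℝ) ^ D) ^ (n + 1) := by
    refine hD.card_le (r := 2 * R₀) (a := m.first)
      ((Finset.erase_subset _ _).trans (h.delegates.centers.trans h.subset))
      (h.subset h.first_mem) (by linarith)
      (fun v hv => hball v (Finset.mem_of_mem_erase hv) (Finset.ne_of_mem_erase hv))
      (fun u hu v hv => hsep u (Finset.mem_of_mem_erase hu) v (Finset.mem_of_mem_erase hv)) ?_
    have h1 : spacing ε k R₀ * (128 * (k / ε)) = 2 * (2 * R₀) := by
      unfold spacing; field_simp; ring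
    rw [← h1]
    exact mul_le_mul_of_nonneg_left hn'.le (spacing_nonneg hε hR₀.le)
  have h2 : ((2 : ℝ) ^ D) ^ (n + 1) ≤ 256 ^ D * (k / ε) ^ D := by
    rw [Real.rpow_pow_comm zero_le_two, ← Real.mul_rpow (by norm_num) (by linarith)]
    refine Real.rpow_le_rpow (by positivity) ?_ hD0
    rw [pow_succ]
    linarith
  have h3 : (1 : ℝ) ≤ 256 ^ D * (k / ε) ^ D :=
    one_le_mul_of_one_le_of_one_le (Real.one_le_rpow (by norm_num) hD0)
      (Real.one_le_rpow hkε hD0)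
  have h4 : (m.Z.card : ℝ) ≤ (m.Z.erase y).card + 1 := by
    have := Finset.pred_card_le_card_erase (s := m.Z) (a := y)
    exact_mod_cast (by omega : m.Z.card ≤ (m.Z.erase y).card + 1)
  linarith

/-- Bounds for the single delegate sets and for the number of centers combine. -/
theorem Invariant.card_delegates_le (hin : IsInput M κ S k) (hε : 0 < ε) (hε1 : ε < 1)
    (h : Invariant M κ k ε S P m) {D : ℝ} (hD : doublingDimension S ≤ D) {b : ℕ}
    (hb : ∀ z ∈ m.Z, (m.D z).card ≤ b) :
    (m.delegates.card : ℝ) ≤ 2 * 256 ^ D * (b * (k / ε) ^ D) := by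
  obtain ⟨hD0, hD⟩ := halvesBalls_of_doublingDimension_le ⟨_, h.subset h.first_mem⟩ hD
  have h1 : m.delegates.card ≤ m.Z.card * b := by
    rw [card_delegates h, ← smul_eq_mul]; exact Finset.sum_le_card_nsmul _ _ _ hb
  calc (m.delegates.card : ℝ) ≤ m.Z.card * b := by exact_mod_cast h1
    _ ≤ 2 * 256 ^ D * (k / ε) ^ D * b := mul_le_mul_of_nonneg_right
        (h.card_centers_le_rpow hin hε hε1 hD0 hD) (Nat.cast_nonneg b)
    _ = _ := by ring

end Bounds

end StreamDMMC

theorem mainTheorem2 (γ : ℕ) :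
    ∃ C₀ : ℝ, ∀ D : ℝ, ∃ C₁ : ℝ,
      ∀ (α : Type*) [MetricSpace α] [DecidableEq α] (S : Finset α) (M : Matroid α)
        (κ : MatroidKind α) (k : ℕ) (ε : ℝ) (xs : List α),
        IsInput M κ S k → κ.BoundedOverlap S γ → 0 < ε → ε < 1 →
        xs.Nodup → xs.toFinset = S → 2 ≤ S.card →
        -- every execution terminates, and what is returned is a coreset
        Terminates M κ k ε 32 xs ∧
        (∃ T, Returns M κ k ε 32 xs T) ∧
        (∀ T, Returns M κ k ε 32 xs T → ∀ δ : DiversityKind, IsCoreset δ M k (1 - ε) S T) ∧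
        -- the working memory, at every moment of the single pass
        (∀ ys m, ys <+: xs → Exec M κ k ε 32 ys m →
          (m.words κ : ℝ) ≤ C₀ * (m.delegates.card : ℝ)) ∧
        -- the size of the union of the delegate sets, at every moment and at the end
        (doublingDimension S ≤ D → ∀ ys m, ys <+: xs → Exec M κ k ε 32 ys m →
          (∀ h A b, κ = .partition h A b →
            (m.delegates.card : ℝ) ≤ C₁ * (k * (k / ε) ^ D)) ∧
          (∀ h A, κ = .transversal h A →
            (m.delegates.card : ℝ) ≤ C₁ * (k ^ 2 * (k / ε) ^ D))) := by
  refine ⟨9 * (γ + 2), fun D => ⟨2 * 256 ^ D, ?_⟩⟩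
  intro α _ _ S M κ k ε xs hin hγ hε hε1 hnd hxs hS
  have hinv : ∀ ys m, ys <+: xs → Exec M κ k ε 32 ys m →
      ∃ P, Invariant M κ k ε S P m ∧ seen P m.ctrl = ys.toFinset := fun ys m hys hm =>
    hm.invariant hin hε hε1 (hnd.sublist hys.sublist) fun y hy => by
      rw [← hxs, List.mem_toFinset]; exact hys.subset hy
  refine ⟨fun ys m hys hm => ?_, ?_, ?_, fun ys m hys hm => ?_, fun hD ys m hys hm => ?_⟩
  · obtain ⟨P, hP, -⟩ := hinv ys m hys hm
    exact ⟨hP.exists_step, hP.acc⟩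
  · have hlen : 2 ≤ xs.length := by
      rw [← List.toFinset_card_of_nodup hnd, hxs]; exact hS
    obtain ⟨x₁, x₂, l, rfl⟩ : ∃ x₁ x₂ l, xs = x₁ :: x₂ :: l := by
      match xs, hlen with
      | x₁ :: x₂ :: l, _ => exact ⟨x₁, x₂, l, rfl⟩
    obtain ⟨m, hm, hc⟩ := exists_exec_ready hin hε hε1 l hnd fun y hy => by
      rw [← hxs, List.mem_toFinset]; exact hy
    exact ⟨_, m, hm, hc, rfl⟩
  · rintro T ⟨m, hm, hc, rfl⟩ δ
    obtain ⟨P, hP, hseen⟩ := hinv xs m (List.prefix_refl xs) hm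
    obtain rfl : P = S := by simpa [hc, seen, hxs] using hseen
    have hctrl := hP.ctrl
    rw [ControlInvariant, hc] at hctrl
    obtain ⟨p, hp⟩ := hctrl.1.clustering
    obtain ⟨y, hy, hyR⟩ := hP.exists_dist_eq
    refine isCoreset_of_dominates δ hin hε hP.first_mem hy hyR
      (fun x hx => ⟨hp.mem x hx, ?_⟩) hp.dominates
    rw [two_mul_spacing]
    exact hp.dist_le x hx
  · obtain ⟨P, hP, -⟩ := hinv ys m hys hm
    exact_mod_cast hP.words_le hin hγ
  · obtain ⟨P, hP, -⟩ := hinv ys m hys hm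
    constructor
    · rintro h A b rfl
      exact hP.card_delegates_le hin hε hε1 hD fun z hz => (hP.delegates.isDelegateSet z hz).2
    · rintro h A rfl
      exact_mod_cast hP.card_delegates_le hin hε hε1 hD fun z hz =>
        (hP.delegates.isDelegateSet z hz).2
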